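/- **Conventions.** $J_\nu$, $Y_\nu$ are the Bessel functions of the first and second kind. For $\mu,\nu\in\mathbb R$ and $t>0$ put $\widetilde\nu=\sqrt{\left(\frac{\mu-1}{2}\right)^2+\nu^2}$, $\widetilde J_{\nu,\mu}(t)=t^{\frac{\mu-1}{2}}J_{\widetilde\nu}(t)$ and $\widetilde Y_{\nu,\mu}(t)=t^{\frac{\mu-1}{2}}Y_{\widetilde\nu}(t)$. The box dimension $\dim_B A$ of a bounded $A\subset\mathbb R^N$ is the common value (if they agree) of $\inf\{s\ge0: \liminf_{\varepsilon\to0}|A_\varepsilon|/\varepsilon^{N-s}=0\}$ and $\inf\{s\ge0: \limsup_{\varepsilon\to0}|A_\varepsilon|/\varepsilon^{N-s}=0\}$, where $A_\varepsilon$ is the open $\varepsilon$-neighbourhood of $A$. The phase dimension $\dim_{ph}(x)$ of a $C^1$ function $x$ on $[\tau_0,\infty)$ is the box dimension of $\{(x(t),\dot x(t)):t\ge\tau_0\}$. A spiral $r=f(\varphi)$, $\varphi\ge\varphi_1>0$ (polar coordinates), is given by a function $f:[\varphi_1,\infty)\to(0,\infty)$ with $f(\varphi)\to0$ as $\varphi\to\infty$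 such that $k\mapsto f(\varphi+2k\pi)$, $k\in\mathbb N$, is strictly decreasing for every $\varphi\ge\varphi_1$. We call $r=g(\varphi)$, $\varphi\le\varphi_1'<0$, a spiral if $r=g(-\varphi)$, $\varphi\ge|\varphi_1'|$, is one. A $C^1$ function $r:[t_0,\infty)\to(0,\infty)$ with $r'(t_0)\le0$ is *wavy* if the sequence starting at $t_0$ and given by $t_{2k+1}=\inf\{t>t_{2k}: r'(t)>0\}$, $t_{2k+2}=\inf\{t>t_{2k+1}: r(t)=r(t_{2k+1})\}$ is well defined, strictly increases to $\infty$, satisfies $t_{2k+1}-t_{2k}\ge\varepsilon$ for some $\varepsilon>0$ and all $k\ge0$, and satisfies, for some $\alpha\in(0,1)$, $\max_{[t_{2k+1},t_{2k+2}]}r-\min_{[t_{2k+1},t_{2k+2}]}r=o(t_{2k+1}^{-\alpha-1})$ as $k\to\infty$. A spiral $r=f(\varphi)$ is a *wavy spiral* if there is a strictly increasing or strictly decreasing $C^1$ function $\varphi(t)$ on some $[t_0,\infty)$, with values in the domain of $f$, such that $r(t)=f(\varphi(t))$ is a wavy function. **Theorem 1 (Generalized Bessel spiral).** Let $\mu\in(0,2)$,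 $\nu\in\mathbb R$, $\tau_0>0$, let $x=\widetilde J_{\nu,\mu}$ or $x=\widetilde Y_{\nu,\mu}$ on $[\tau_0,\infty)$, and let $\Gamma=\{(x(t),\dot x(t)):t\in[\tau_0,\infty)\}$. Then: 1. $x$ is $C^1$ and $\dim_{ph}(x)=\dim_B\Gamma=\frac{4}{4-\mu}$. 2. There is a continuous function $\varphi$ on $[\tau_0,\infty)$ with $\tan\varphi(t)=\dot x(t)/x(t)$ whenever $x(t)\ne0$. For each such $\varphi$, after adding the constant $\pi$ if necessary, $\varphi(t)$ is a polar angle of $(x(t),\dot x(t))$ for all $t\ge\tau_0$, and there are $T\ge\tau_0$, $\phi_0>0$ and $g:(-\infty,-\phi_0]\to(0,\infty)$ such that $\varphi$ maps $[T,\infty)$ strictly decreasingly onto $(-\infty,-\phi_0]$, $g(\varphi(t))=\sqrt{x(t)^2+\dot x(t)^2}$ for $t\ge T$, the curve $\{(x(t),\dot x(t)):t\ge T\}$ is the curve $r=g(\varphi)$, $\varphi\in(-\infty,-\phi_0]$, in polar coordinates, it coincides with $\Gamma$ in some neighbourhood of the origin, it is a spiral, and $g(\varphi)\simeq|\varphi|^{-\frac{2-\mu}{2}}$,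 i.e. $C|\varphi|^{-\frac{2-\mu}{2}}\le g(\varphi)\le D|\varphi|^{-\frac{2-\mu}{2}}$ for some constants $C,D>0$ and all $\varphi$ sufficiently close to $-\infty$. 3. This spiral $r=g(\varphi)$ (that is, $\Gamma$ near the origin) is a wavy spiral if and only if $\nu\ne0$. -/

import Mathlib

open Set Filter Topology MeasureTheory

noncomputable section

/-! ### Bessel functions and their generalization -/

/-- Bessel function of the first kind of real order `ν`, for `t > 0`, by its power series.
`Real.Gamma` is `0` at its poles, so `(Real.Gamma s)⁻¹` is the reciprocal Gamma function. -/
def besselJ (ν t : ℝ) : ℝ :=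
  ∑' m : ℕ, (-1 : ℝ) ^ m * ((m.factorial : ℝ))⁻¹ * (Real.Gamma ((m : ℝ) + ν + 1))⁻¹ *
    (t / 2) ^ (2 * (m : ℝ) + ν)

/-- The quotient `(J_ν(t) cos νπ - J_{-ν}(t)) / sin νπ`. -/
def besselYQuot (ν t : ℝ) : ℝ :=
  (besselJ ν t * Real.cos (ν * Real.pi) - besselJ (-ν) t) / Real.sin (ν * Real.pi)

open scoped Classical in
/-- Bessel function of the second kind of real order `ν`, for `t > 0`: the quotient above if `ν`
is not an integer, and the limit of the quotient as the order tends to `ν` if it is one. -/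
def besselY (ν t : ℝ) : ℝ :=
  if ∃ n : ℤ, ν = n then limUnder (𝓝[≠] ν) (fun s => besselYQuot s t) else besselYQuot ν t

/-- The order `ν̃ = √(((μ-1)/2)² + ν²)`. -/
def besselOrder (ν μ : ℝ) : ℝ := Real.sqrt (((μ - 1) / 2) ^ 2 + ν ^ 2)

/-- Generalized Bessel function `t ^ ((μ-1)/2) J_ν̃(t)`. -/
def genBesselJ (ν μ t : ℝ) : ℝ := t ^ ((μ - 1) / 2) * besselJ (besselOrder ν μ) t

/-- Generalized Bessel function `t ^ ((μ-1)/2) Y_ν̃(t)`. -/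
def genBesselY (ν μ t : ℝ) : ℝ := t ^ ((μ - 1) / 2) * besselY (besselOrder ν μ) t

/-! ### Box dimension -/

/-- Lower `s`-dimensional Minkowski content of `A ⊆ ℝᴺ`. -/
def lowerMinkowskiContent {N : ℕ} (s : ℝ) (A : Set (EuclideanSpace ℝ (Fin N))) : ENNReal :=
  liminf (fun ε : ℝ => volume (Metric.thickening ε A) / ENNReal.ofReal (ε ^ ((N : ℝ) - s)))
    (𝓝[>] 0)

/-- Upper `s`-dimensional Minkowski content of `A ⊆ ℝᴺ`. -/
def upperMinkowskiContent {N : ℕ} (s : ℝ) (A : Set (EuclideanSpace ℝ (Fin N))) : ENNReal :=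
  limsup (fun ε : ℝ => volume (Metric.thickening ε A) / ENNReal.ofReal (ε ^ ((N : ℝ) - s)))
    (𝓝[>] 0)

/-- Lower box dimension. -/
def lowerBoxDim {N : ℕ} (A : Set (EuclideanSpace ℝ (Fin N))) : ℝ :=
  sInf {s : ℝ | 0 ≤ s ∧ lowerMinkowskiContent s A = 0}

/-- Upper box dimension. -/
def upperBoxDim {N : ℕ} (A : Set (EuclideanSpace ℝ (Fin N))) : ℝ :=
  sInf {s : ℝ | 0 ≤ s ∧ upperMinkowskiContent s A = 0}

/-- The bounded set `A` has box dimension `d`: lower and upper box dimensions both equal `d`. -/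
def HasBoxDim {N : ℕ} (A : Set (EuclideanSpace ℝ (Fin N))) (d : ℝ) : Prop :=
  Bornology.IsBounded A ∧ lowerBoxDim A = d ∧ upperBoxDim A = d

/-! ### Phase curves -/

/-- The phase curve `{(x(t), ẋ(t)) : t ≥ t₀}`. -/
def phaseCurve (x : ℝ → ℝ) (t₀ : ℝ) : Set (EuclideanSpace ℝ (Fin 2)) :=
  (fun t => !₂[x t, deriv x t]) '' Ici t₀

/-- The function `x` on `[t₀, ∞)` is of class `C¹` and has phase dimension `d`. -/
def HasPhaseDim (x : ℝ → ℝ) (t₀ d : ℝ) : Prop :=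
  (∀ t ∈ Ici t₀, ContDiffAt ℝ 1 x t) ∧ HasBoxDim (phaseCurve x t₀) d

/-- The distance `√(x(t)² + ẋ(t)²)` of the phase point from the origin. -/
def phaseRadius (x : ℝ → ℝ) (t : ℝ) : ℝ := Real.sqrt (x t ^ 2 + deriv x t ^ 2)

/-- `φ` is a continuous function on `[t₀, ∞)` with `tan φ(t) = ẋ(t) / x(t)` where
`x(t) ≠ 0`; there `tan φ(t)` has to be defined, that is, `cos φ(t) ≠ 0`. -/
def IsPhaseFunction (x : ℝ → ℝ) (t₀ : ℝ) (φ : ℝ → ℝ) : Prop :=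
  ContinuousOn φ (Ici t₀) ∧ ∀ t ∈ Ici t₀, x t ≠ 0 →
    Real.cos (φ t) ≠ 0 ∧ Real.tan (φ t) = deriv x t / x t

/-! ### Spirals -/

/-- The set with equation `r = f(φ)`, `φ ∈ S`, in polar coordinates. -/
def polarGraph (f : ℝ → ℝ) (S : Set ℝ) : Set (EuclideanSpace ℝ (Fin 2)) :=
  (fun φ => !₂[f φ * Real.cos φ, f φ * Real.sin φ]) '' S

/-- `r = f(φ)`, `φ ≥ φ₁ > 0`, is a spiral: `f` is positive, tends to `0` and is radially
decreasing. -/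
structure IsSpiral (f : ℝ → ℝ) (φ₁ : ℝ) : Prop where
  start_pos : 0 < φ₁
  pos : ∀ φ ∈ Ici φ₁, 0 < f φ
  tendsto_zero : Tendsto f atTop (𝓝 0)
  radially_decreasing : ∀ φ ∈ Ici φ₁, StrictAnti (fun k : ℕ => f (φ + 2 * (k : ℝ) * Real.pi))

/-- `r = g(φ)`, `φ ≤ φ₁ < 0`, is a spiral: its mirror image `r = g(-φ)`, `φ ≥ |φ₁|`, is one. -/
def IsNegSpiral (g : ℝ → ℝ) (φ₁ : ℝ) : Prop :=
  φ₁ < 0 ∧ IsSpiral (fun φ => g (-φ)) |φ₁|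

/-! ### Waviness -/

/-- Oscillation (maximum minus minimum) of `r` on `[a, b]`. -/
def oscOn (r : ℝ → ℝ) (a b : ℝ) : ℝ := sSup (r '' Icc a b) - sInf (r '' Icc a b)

/-- `r` on `[t₀, ∞)` is a wavy function. An `IsGLB` of a set of reals exists only if the set is
non-empty, so the recursion conditions contain that the sequence `t` is well defined. -/
def IsWavyFunction (r : ℝ → ℝ) (t₀ : ℝ) : Prop :=
  ContDiffOn ℝ 1 r (Ici t₀) ∧ (∀ s ∈ Ici t₀, 0 < r s) ∧ derivWithin r (Ici t₀) t₀ ≤ 0 ∧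
  ∃ t : ℕ → ℝ, t 0 = t₀ ∧
    (∀ k : ℕ, IsGLB {s : ℝ | t (2 * k) < s ∧ 0 < derivWithin r (Ici t₀) s} (t (2 * k + 1))) ∧
    (∀ k : ℕ, IsGLB {s : ℝ | t (2 * k + 1) < s ∧ r s = r (t (2 * k + 1))} (t (2 * k + 2))) ∧
    (StrictMono t ∧ Tendsto t atTop atTop) ∧
    (∃ ε : ℝ, 0 < ε ∧ ∀ k : ℕ, ε ≤ t (2 * k + 1) - t (2 * k)) ∧
    (∃ α ∈ Ioo (0 : ℝ) 1,
      (fun k : ℕ => oscOn r (t (2 * k + 1)) (t (2 * k + 2)))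
        =o[atTop] (fun k : ℕ => (t (2 * k + 1)) ^ (-α - 1)))

/-- The spiral `r = f(φ)`, `φ ∈ S`, is a wavy spiral: `t ↦ f(φ(t))` is a wavy function for some
increasing or decreasing `C¹` function `φ : [t₀, ∞) → S`. -/
def IsWavySpiral (f : ℝ → ℝ) (S : Set ℝ) : Prop :=
  ∃ (t₀ : ℝ) (φ : ℝ → ℝ), ContDiffOn ℝ 1 φ (Ici t₀) ∧ MapsTo φ (Ici t₀) S ∧
    (StrictMonoOn φ (Ici t₀) ∨ StrictAntiOn φ (Ici t₀)) ∧
    IsWavyFunction (fun t => f (φ t)) t₀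

end

/-!
A generalized Bessel function `x` solves `x'' + (2α/t) x' + (1 - κ/t²) x = 0` on `(0, ∞)` with
`α = (2 - μ)/2 ∈ (0, 1)` and `κ = ν²`, and it does not vanish identically
(`exists_solvesPhase_genBessel`). Every assertion of the theorem holds for every non-trivial solution
of this equation, so no asymptotic expansion of Bessel functions is needed. That `J_s` and `Y_s` are
solutions is read off from the power series; at integer orders `Y_n` is a combination of the
derivatives of `J_s` with respect to `s` at `s = ± n`, which are computed termwise, and
non-triviality follows from the behaviour at the origin.

Three facts about the equation carry the proof.

* The energy `u² + u'²` of `u = t^α x` has logarithmic derivative `O(t⁻²)`. Hence it never vanishes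
  and the radius `r = √(x² + x'²)` is comparable to `t^(-α)` (`SolvesPhase.exists_radius_bounds`).
* In polar coordinates (`PruferPair`), `θ' = -1 + O(1/t)` and
  `r'/r = -(2α/t) sin² θ + (κ/t²) sin θ cos θ`. So `|θ|` is comparable to `t`, and during one turn
  the first term of `r'/r` dominates: the radius decreases, by at most a multiple of
  `|θ|^(-α-1)`. This is the spiral, its rate and its spacing.
* `r'` has the sign of `-sin θ sin (θ - β)` with `tan β = κ/(2αt)`. For `κ > 0` the radius increases
  exactly on the short time intervals where `θ` lies between `β` and `0` modulo `π`, each time by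
  only `O(t^(-α-2))`, which the damping undoes within a quarter turn; this is waviness
  (`PruferPair.isWavySpiral_polarRadius`). For `κ = 0` the radius is a monotone function of the
  angle, and then no parametrization is wavy (`not_isWavySpiral_of_monotoneOn`).

For the box dimension, the `ε`-neighbourhood of the curve contains the disc enclosed by the turns
that are less than `ε` apart; they begin at `|θ|` of order `ε^(-1/(1+α))`, so the area of the disc is
of order `ε^(2α/(1+α))`. Conversely the arc before the time `ε^(-1/(1+α))` has a length that yields
a neighbourhood of this same order of area, and the rest lies in a disc of this order. Therefore
`2 - dim = 2α/(1+α)`.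
-/

/-! ### Box dimension from two-sided volume bounds -/

/-- If the `ε`-neighbourhood has volume of exact order `ε ^ (N - d)`, both Minkowski contents vanish
precisely for `s > d`. -/
theorem hasBoxDim_of_volume_bounds {N : ℕ} {A : Set (EuclideanSpace ℝ (Fin N))}
    (hA : Bornology.IsBounded A) {d k K : ℝ} (hd : 0 ≤ d) (hk : 0 < k)
    (hlow : ∀ᶠ ε : ℝ in 𝓝[>] 0,
      ENNReal.ofReal (k * ε ^ ((N : ℝ) - d)) ≤ volume (Metric.thickening ε A))
    (hup : ∀ᶠ ε : ℝ in 𝓝[>] 0,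
      volume (Metric.thickening ε A) ≤ ENNReal.ofReal (K * ε ^ ((N : ℝ) - d))) :
    HasBoxDim A d := by
  have hle : ∀ s : ℝ, lowerMinkowskiContent s A ≤ upperMinkowskiContent s A := fun s =>
    liminf_le_limsup
  have hbig : ∀ s : ℝ, d < s → upperMinkowskiContent s A = 0 := by
    intro s hs
    have hz : Tendsto (fun ε : ℝ => ENNReal.ofReal (K * ε ^ (s - d))) (𝓝[>] 0) (𝓝 0) := by
      have h1 : Tendsto (fun ε : ℝ => K * ε ^ (s - d)) (𝓝[>] 0) (𝓝 (K * (0 : ℝ) ^ (s - d))) :=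
        ((Real.continuousAt_rpow_const 0 (s - d) (Or.inr (by linarith))).tendsto.mono_left
          nhdsWithin_le_nhds).const_mul K
      rw [Real.zero_rpow (by linarith), mul_zero] at h1
      simpa [Function.comp_def] using (ENNReal.continuous_ofReal.tendsto 0).comp h1
    have hq : Tendsto (fun ε : ℝ => volume (Metric.thickening ε A) /
        ENNReal.ofReal (ε ^ ((N : ℝ) - s))) (𝓝[>] 0) (𝓝 0) := by
      refine tendsto_of_tendsto_of_tendsto_of_le_of_le' tendsto_const_nhds hz
        (Eventually.of_forall fun _ => zero_le) ?_
      filter_upwards [hup, self_mem_nhdsWithin] with ε h1 h2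
      have h2 : 0 < ε := h2
      refine ENNReal.div_le_of_le_mul (h1.trans (le_of_eq ?_))
      rw [← ENNReal.ofReal_mul' (by positivity), mul_assoc, ← Real.rpow_add h2]
      congr 3; ring
    exact hq.limsup_eq
  have hsmall : ∀ s : ℝ, s ≤ d → lowerMinkowskiContent s A ≠ 0 := by
    intro s hs
    have h : ENNReal.ofReal k ≤ lowerMinkowskiContent s A := by
      refine le_liminf_of_le (by isBoundedDefault) ?_
      have h01 : Iio (1 : ℝ) ∈ 𝓝[>] (0 : ℝ) := mem_nhdsWithin_of_mem_nhds (Iio_mem_nhds one_pos)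
      filter_upwards [hlow, self_mem_nhdsWithin, h01] with ε h1 h2 h3
      have h2 : 0 < ε := h2
      have h3 : ε < 1 := h3
      have hpos : 0 < ε ^ ((N : ℝ) - s) := Real.rpow_pos_of_pos h2 _
      rw [ENNReal.le_div_iff_mul_le (Or.inl (by simpa using hpos)) (Or.inl ENNReal.ofReal_ne_top),
        ← ENNReal.ofReal_mul hk.le]
      refine le_trans (ENNReal.ofReal_le_ofReal ?_) h1
      exact mul_le_mul_of_nonneg_left
        (Real.rpow_le_rpow_of_exponent_ge h2 h3.le (by linarith)) hk.le
    intro h0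
    rw [h0] at h
    simp only [nonpos_iff_eq_zero, ENNReal.ofReal_eq_zero] at h
    linarith
  have e1 : {s : ℝ | 0 ≤ s ∧ lowerMinkowskiContent s A = 0} = Ioi d := by
    ext s
    refine ⟨fun h => not_le.1 fun hs => hsmall s hs h.2, fun h => ⟨hd.trans (le_of_lt h), ?_⟩⟩
    exact le_antisymm ((hle s).trans (hbig s h).le) zero_le
  have e2 : {s : ℝ | 0 ≤ s ∧ upperMinkowskiContent s A = 0} = Ioi d := by
    ext s
    refine ⟨fun h => not_le.1 fun hs => hsmall s hs ?_, fun h => ⟨hd.trans (le_of_lt h), hbig s h⟩⟩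
    exact le_antisymm ((hle s).trans h.2.le) zero_le
  exact ⟨hA, by rw [lowerBoxDim, e1, csInf_Ioi], by rw [upperBoxDim, e2, csInf_Ioi]⟩

/-! ### Area of neighbourhoods of spirals -/

theorem dist_toLp_polar (a b ω : ℝ) :
    dist (!₂[a * Real.cos ω, a * Real.sin ω] : EuclideanSpace ℝ (Fin 2))
      !₂[b * Real.cos ω, b * Real.sin ω] = |a - b| := by
  rw [EuclideanSpace.dist_eq, Fin.sum_univ_two]
  simp only [Matrix.cons_val_zero, Matrix.cons_val_one, Real.dist_eq, sq_abs]
  rw [← Real.sqrt_sq_eq_abs]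
  congr 1
  linear_combination (a - b) ^ 2 * Real.sin_sq_add_cos_sq ω

theorem dist_toLp_le (a b c d : ℝ) :
    dist (!₂[a, b] : EuclideanSpace ℝ (Fin 2)) !₂[c, d] ≤ |a - c| + |b - d| := by
  rw [EuclideanSpace.dist_eq, Fin.sum_univ_two]
  simp only [Matrix.cons_val_zero, Matrix.cons_val_one, Real.dist_eq, sq_abs]
  refine Real.sqrt_le_iff.2 ⟨by positivity, ?_⟩
  nlinarith [sq_abs (a - c), sq_abs (b - d), mul_nonneg (abs_nonneg (a - c)) (abs_nonneg (b - d))]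

theorem norm_toLp_pair (a b : ℝ) :
    ‖(!₂[a, b] : EuclideanSpace ℝ (Fin 2))‖ = Real.sqrt (a ^ 2 + b ^ 2) := by
  rw [EuclideanSpace.norm_eq, Fin.sum_univ_two]
  simp

/-- Every point of the plane has polar coordinates with the angle in a prescribed period. -/
theorem exists_polar (p : EuclideanSpace ℝ (Fin 2)) (Φ : ℝ) :
    ∃ ω ∈ Ioc (-Φ - 2 * Real.pi) (-Φ), p = !₂[‖p‖ * Real.cos ω, ‖p‖ * Real.sin ω] := by
  set z : ℂ := ⟨p 0, p 1⟩ with hz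
  have hn : ‖p‖ = ‖z‖ := by
    rw [EuclideanSpace.norm_eq, Fin.sum_univ_two, Complex.norm_eq_sqrt_sq_add_sq]
    simp [hz]
  obtain ⟨ω, hω, m, hm⟩ : ∃ ω ∈ Ioc (-Φ - 2 * Real.pi) (-Φ), ∃ m : ℤ,
      ω = Complex.arg z + m * (2 * Real.pi) := by
    refine ⟨toIocMod Real.two_pi_pos (-Φ - 2 * Real.pi) (Complex.arg z), ?_,
      -toIocDiv Real.two_pi_pos (-Φ - 2 * Real.pi) (Complex.arg z), ?_⟩
    · have := toIocMod_mem_Ioc Real.two_pi_pos (-Φ - 2 * Real.pi) (Complex.arg z)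
      simpa using this
    · rw [toIocMod, zsmul_eq_mul]; push_cast; ring
  refine ⟨ω, hω, ?_⟩
  ext i
  fin_cases i
  · simp [hm, hn, Real.cos_add_int_mul_two_pi, Complex.norm_mul_cos_arg, hz]
  · simp [hm, hn, Real.sin_add_int_mul_two_pi, Complex.norm_mul_sin_arg, hz]

/-- If consecutive turns of a spiral beyond the angle `-Φ` are less than `ε` apart, its
`ε`-neighbourhood contains every disc centred at the origin that the turns beyond `-Φ` enclose. -/
theorem ball_subset_thickening_polarGraph {g : ℝ → ℝ} {φ₀ Φ ε ρ : ℝ} (hΦ : φ₀ ≤ Φ) (hε : 0 < ε)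
    (hzero : Tendsto g atBot (𝓝 0))
    (hgap : ∀ θ ≤ -Φ, g θ - g (θ - 2 * Real.pi) < ε)
    (hρ : ∀ θ ∈ Icc (-Φ - 2 * Real.pi) (-Φ), ρ ≤ g θ) :
    Metric.ball 0 ρ ⊆ Metric.thickening ε (polarGraph g (Iic (-φ₀))) := by
  intro p hp
  have hp : ‖p‖ < ρ := by simpa using hp
  obtain ⟨ω, hω, hpω⟩ := exists_polar p Φ
  set u : ℕ → ℝ := fun k => ω - k * (2 * Real.pi) with hu
  have hpi := Real.pi_pos
  have hule : ∀ k, u k ≤ -Φ := fun k => by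
    have : (0 : ℝ) ≤ k * (2 * Real.pi) := by positivity
    simp only [hu]; linarith [hω.2]
  have hutend : Tendsto u atTop atBot := by
    refine tendsto_atBot_add_const_left _ _ ?_ |>.congr fun k => (sub_eq_add_neg _ _).symm
    exact tendsto_neg_atTop_atBot.comp
      (tendsto_natCast_atTop_atTop.atTop_mul_const Real.two_pi_pos)
  have hex : ∃ k, g (u k) < ‖p‖ + ε := by
    have := (hzero.comp hutend).eventually (gt_mem_nhds (show (0 : ℝ) < ‖p‖ + ε by positivity))
    exact this.exists
  classical
  have hk := Nat.find_spec hex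
  have hlow : ‖p‖ - ε < g (u (Nat.find hex)) := by
    rcases Nat.eq_zero_or_pos (Nat.find hex) with h0 | h0
    · rw [h0]
      have : ρ ≤ g (u 0) := hρ _ ⟨by simp only [hu]; push_cast; linarith [hω.1], hule 0⟩
      linarith
    · obtain ⟨j, hj⟩ := Nat.exists_eq_succ_of_ne_zero h0.ne'
      have h1 := Nat.find_min hex (show j < Nat.find hex by omega)
      have h2 := hgap (u j) (hule j)
      have h3 : u (Nat.find hex) = u j - 2 * Real.pi := by
        rw [hj]; simp only [hu]; push_cast; ring
      rw [h3]; linarith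
  refine Metric.mem_thickening_iff.2 ⟨_, mem_image_of_mem _
    (show u (Nat.find hex) ∈ Iic (-φ₀) from (hule _).trans (by linarith)), ?_⟩
  have hc : Real.cos (u (Nat.find hex)) = Real.cos ω := Real.cos_sub_nat_mul_two_pi _ _
  have hs : Real.sin (u (Nat.find hex)) = Real.sin ω := Real.sin_sub_nat_mul_two_pi _ _
  rw [hc, hs]
  nth_rewrite 1 [hpω]
  rw [dist_toLp_polar, abs_lt]
  constructor <;> linarith

theorem volume_ball_plane (p : EuclideanSpace ℝ (Fin 2)) {r : ℝ} (hr : 0 ≤ r) :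
    volume (Metric.ball p r) = ENNReal.ofReal (Real.pi * r ^ 2) := by
  rw [EuclideanSpace.volume_ball_fin_two, ← ENNReal.ofReal_pow hr, mul_comm Real.pi,
    ENNReal.ofReal_mul (by positivity)]

/-- Lower area bound: a spiral with radii `≳ |θ|^(-α)` and gaps `≲ |θ|^(-α-1)` between consecutive
turns has an `ε`-neighbourhood of area `≳ ε^(2α/(1+α))`. -/
theorem volume_thickening_polarGraph_ge {g : ℝ → ℝ} {φ₀ α c C : ℝ} (hα : 0 < α)
    (hc : 0 < c) (hC : 0 < C) (hφ₀ : 0 < φ₀)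
    (hzero : Tendsto g atBot (𝓝 0))
    (hgap : ∀ θ ≤ -φ₀, g θ - g (θ - 2 * Real.pi) ≤ C * |θ| ^ (-α - 1))
    (hlow : ∀ θ ≤ -φ₀, c * |θ| ^ (-α) ≤ g θ) :
    ∃ k : ℝ, 0 < k ∧ ∀ᶠ ε : ℝ in 𝓝[>] 0, ENNReal.ofReal (k * ε ^ (2 * α / (1 + α))) ≤
      volume (Metric.thickening ε (polarGraph g (Iic (-φ₀)))) := by
  -- beyond the angle `Φ = M ε ^ (-1 / (1 + α))` the turns are at most `ε / 2` apart
  set M : ℝ := (2 * C) ^ (1 / (1 + α)) with hM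
  have hMpos : 0 < M := by positivity
  refine ⟨Real.pi * (c * (2 * M) ^ (-α)) ^ 2, by positivity, ?_⟩
  have hlim : Tendsto (fun ε : ℝ => M * ε ^ (-(1 / (1 + α)))) (𝓝[>] 0) atTop :=
    (tendsto_rpow_neg_nhdsGT_zero (by simp; linarith)).const_mul_atTop hMpos
  filter_upwards [hlim.eventually_ge_atTop φ₀, hlim.eventually_ge_atTop (2 * Real.pi),
    self_mem_nhdsWithin] with ε h1 h2 hε
  have hε : 0 < ε := hε
  set Φ : ℝ := M * ε ^ (-(1 / (1 + α))) with hΦ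
  have hΦpos : 0 < Φ := by positivity
  have hΦpow : Φ ^ (-α - 1) = ε / (2 * C) := by
    rw [hΦ, hM, Real.mul_rpow (by positivity) (by positivity), ← Real.rpow_mul (by positivity),
      ← Real.rpow_mul hε.le]
    have e1 : 1 / (1 + α) * (-α - 1) = -1 := by field_simp; ring
    have e2 : -(1 / (1 + α)) * (-α - 1) = 1 := by field_simp; ring
    rw [e1, e2, Real.rpow_one, Real.rpow_neg_one]; field_simp
  have hsub := ball_subset_thickening_polarGraph (g := g) (ρ := c * (2 * Φ) ^ (-α)) h1 hε hzero
    (fun θ hθ => by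
      refine (hgap θ (hθ.trans (by linarith))).trans_lt ?_
      have h3 : Φ ≤ |θ| := by rw [abs_of_neg (by linarith)]; linarith
      have h4 : |θ| ^ (-α - 1) ≤ Φ ^ (-α - 1) :=
        Real.rpow_le_rpow_of_nonpos hΦpos h3 (by linarith)
      rw [hΦpow] at h4
      calc C * |θ| ^ (-α - 1) ≤ C * (ε / (2 * C)) := by gcongr
        _ = ε / 2 := by field_simp
        _ < ε := by linarith)
    (fun θ hθ => by
      refine le_trans ?_ (hlow θ (hθ.2.trans (by linarith)))
      have hθ0 : 0 < |θ| := abs_pos.2 (by linarith [hθ.2])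
      have h3 : |θ| ≤ 2 * Φ := by
        rw [abs_of_neg (by linarith [hθ.2])]; linarith [hθ.1]
      exact mul_le_mul_of_nonneg_left (Real.rpow_le_rpow_of_nonpos hθ0 h3 (by linarith)) hc.le)
  refine le_trans (le_of_eq ?_) (measure_mono hsub)
  rw [volume_ball_plane _ (by positivity)]
  congr 1
  have e3 : (2 * Φ) ^ (-α) = (2 * M) ^ (-α) * ε ^ (α / (1 + α)) := by
    rw [hΦ, ← mul_assoc, Real.mul_rpow (by positivity) (by positivity), ← Real.rpow_mul hε.le]
    congr 2; field_simp
  have e4 : ε ^ (2 * α / (1 + α)) = (ε ^ (α / (1 + α))) ^ 2 := by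
    rw [← Real.rpow_mul_natCast hε.le]; congr 1; push_cast; ring
  rw [e3, e4]; ring

/-- Upper area bound: a curve `γ` with `‖γ t‖ ≤ C t^(-α)` and speed `≲ t^(-α)` has an
`ε`-neighbourhood of area `≲ ε^(2α/(1+α))`. Up to the time `ε^(-1/(1+α))` it is covered by discs of
radius `2ε`, whose number is the length of the arc over `ε`; after that time it stays in one small
disc around the origin. -/
theorem volume_thickening_curve_le {γ : ℝ → EuclideanSpace ℝ (Fin 2)} {τ α C D : ℝ} (hτ : 0 < τ)
    (hα : 0 < α) (hα' : α < 1) (hC : 0 < C) (hD : 0 < D)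
    (hnorm : ∀ t ∈ Ici τ, ‖γ t‖ ≤ C * t ^ (-α))
    (hdist : ∀ s ∈ Ici τ, ∀ t ∈ Ici τ, dist (γ s) (γ t) ≤ |D * s ^ (1 - α) - D * t ^ (1 - α)|) :
    ∃ K : ℝ, ∀ᶠ ε : ℝ in 𝓝[>] 0,
      volume (Metric.thickening ε (γ '' Ici τ)) ≤ ENNReal.ofReal (K * ε ^ (2 * α / (1 + α))) := by
  refine ⟨Real.pi * (4 * (D + 1)) + Real.pi * (C + 1) ^ 2, ?_⟩
  have h01 : Iio (1 : ℝ) ∈ 𝓝[>] (0 : ℝ) := mem_nhdsWithin_of_mem_nhds (Iio_mem_nhds one_pos)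
  filter_upwards [self_mem_nhdsWithin, h01] with ε hε hε1
  have hε : 0 < ε := hε
  have hε1 : ε < 1 := hε1
  set η : ℝ := ε ^ (1 / (1 + α)) with hη
  have hηpos : 0 < η := by positivity
  have hη1 : η ≤ 1 := Real.rpow_le_one hε.le hε1.le (by positivity)
  have hεη : ε = η ^ (1 + α) := by
    rw [hη, ← Real.rpow_mul hε.le]; field_simp; simp
  have hηα : ε ^ (2 * α / (1 + α)) = η ^ (2 * α) := by
    rw [hη, ← Real.rpow_mul hε.le]; congr 1; field_simp
  set S : ℝ → ℝ := fun t => D * t ^ (1 - α) with hS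
  have hSpos : ∀ t ∈ Ici τ, 0 ≤ S t := fun t ht => by
    have : 0 < t := hτ.trans_le ht
    simp only [hS]; positivity
  set n : ℝ → ℕ := fun t => ⌊S t / ε⌋₊
  set N : ℕ := ⌊S η⁻¹ / ε⌋₊
  -- `q j` is a time at which the bound `S` for the arc length, rounded down to a multiple of `ε`, equals `j ε`
  obtain ⟨q, hq⟩ : ∃ q : ℕ → ℝ, ∀ t ∈ Ici τ, q (n t) ∈ Ici τ ∧ n (q (n t)) = n t := by
    refine ⟨fun j => Function.invFunOn n (Ici τ) j, fun t ht => ?_⟩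
    exact ⟨Function.invFunOn_mem ⟨t, ht, rfl⟩, Function.invFunOn_eq ⟨t, ht, rfl⟩⟩
  have hcover : Metric.thickening ε (γ '' Ici τ) ⊆
      (⋃ j ∈ Finset.range (N + 1), Metric.ball (γ (q j)) (2 * ε)) ∪
        Metric.ball 0 (C * η ^ α + ε) := by
    intro p hp
    obtain ⟨_, ⟨t, ht, rfl⟩, hpt⟩ := Metric.mem_thickening_iff.1 hp
    have ht0 : 0 < t := hτ.trans_le ht
    rcases le_total t η⁻¹ with h | h
    · left
      simp only [mem_iUnion, Finset.mem_range, exists_prop]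
      refine ⟨n t, Nat.lt_succ_of_le (Nat.floor_le_floor ?_), ?_⟩
      · have : t ^ (1 - α) ≤ η⁻¹ ^ (1 - α) := Real.rpow_le_rpow ht0.le h (by linarith)
        simp only [hS]; gcongr
      · have h1 := hdist t ht _ (hq t ht).1
        have h2 : |S t - S (q (n t))| ≤ ε := by
          have a1 := Nat.floor_le (div_nonneg (hSpos t ht) hε.le)
          have a2 := Nat.lt_floor_add_one (S t / ε)
          have a3 := Nat.floor_le (div_nonneg (hSpos _ (hq t ht).1) hε.le)
          have a4 := Nat.lt_floor_add_one (S (q (n t)) / ε)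
          have a5 : (⌊S (q (n t)) / ε⌋₊ : ℝ) = ⌊S t / ε⌋₊ := by exact_mod_cast (hq t ht).2
          have a6 : |S t / ε - S (q (n t)) / ε| ≤ 1 := abs_le.2 ⟨by linarith, by linarith⟩
          rw [← sub_div, abs_div, abs_of_pos hε, div_le_one hε] at a6
          exact a6
        rw [Metric.mem_ball]
        calc dist p (γ (q (n t))) ≤ dist p (γ t) + dist (γ t) (γ (q (n t))) := dist_triangle _ _ _
          _ < 2 * ε := by linarith
    · right
      have h1 : t ^ (-α) ≤ η ^ α := by
        rw [← inv_inv (η ^ α), ← Real.inv_rpow hηpos.le, ← Real.rpow_neg (by positivity)]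
        exact Real.rpow_le_rpow_of_nonpos (by positivity) h (by linarith)
      have h2 : ‖γ t‖ ≤ C * η ^ α := (hnorm t ht).trans (by gcongr)
      rw [mem_ball_zero_iff]
      calc ‖p‖ = ‖(p - γ t) + γ t‖ := by simp
        _ ≤ ‖p - γ t‖ + ‖γ t‖ := norm_add_le _ _
        _ < C * η ^ α + ε := by rw [← dist_eq_norm]; linarith
  have hNle : (N : ℝ) * ε ^ 2 ≤ D * η ^ (2 * α) := by
    have a1 : (N : ℝ) ≤ S η⁻¹ / ε := Nat.floor_le (div_nonneg (by simp only [hS]; positivity) hε.le)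
    have a2 : S η⁻¹ / ε * ε ^ 2 = D * η ^ (2 * α) := by
      have : S η⁻¹ / ε * ε ^ 2 = S η⁻¹ * ε := by field_simp
      rw [this]
      simp only [hS]
      rw [Real.inv_rpow hηpos.le, ← Real.rpow_neg hηpos.le, mul_assoc]
      nth_rewrite 1 [hεη]
      rw [← Real.rpow_add hηpos]
      congr 2; ring
    calc (N : ℝ) * ε ^ 2 ≤ S η⁻¹ / ε * ε ^ 2 := by gcongr
      _ = _ := a2
  have hε2 : ε ^ 2 ≤ η ^ (2 * α) := by
    rw [hεη, ← Real.rpow_mul_natCast hηpos.le]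
    exact Real.rpow_le_rpow_of_exponent_ge hηpos hη1 (by push_cast; linarith)
  have hεα : ε ≤ η ^ α := by
    nth_rewrite 1 [hεη]
    exact Real.rpow_le_rpow_of_exponent_ge hηpos hη1 (by linarith)
  calc volume (Metric.thickening ε (γ '' Ici τ))
      ≤ volume (⋃ j ∈ Finset.range (N + 1), Metric.ball (γ (q j)) (2 * ε)) +
        volume (Metric.ball (0 : EuclideanSpace ℝ (Fin 2)) (C * η ^ α + ε)) :=
        (measure_mono hcover).trans (measure_union_le _ _)
    _ ≤ ∑ j ∈ Finset.range (N + 1), volume (Metric.ball (γ (q j)) (2 * ε)) +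
        volume (Metric.ball (0 : EuclideanSpace ℝ (Fin 2)) (C * η ^ α + ε)) := by
        gcongr; exact measure_biUnion_finset_le _ _
    _ = ENNReal.ofReal ((N + 1) * (Real.pi * (2 * ε) ^ 2) + Real.pi * (C * η ^ α + ε) ^ 2) := by
        simp only [volume_ball_plane _ (show 0 ≤ 2 * ε by positivity)]
        rw [volume_ball_plane _ (by positivity), Finset.sum_const, Finset.card_range,
          ENNReal.ofReal_add (by positivity) (by positivity), nsmul_eq_mul,
          ENNReal.ofReal_mul (p := (N : ℝ) + 1) (by positivity)]
        congr 2
        rw [← Nat.cast_succ, ENNReal.ofReal_natCast]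
    _ ≤ _ := by
        refine ENNReal.ofReal_le_ofReal ?_
        rw [hηα, add_mul]
        have b1 : (C * η ^ α + ε) ^ 2 ≤ (C + 1) ^ 2 * η ^ (2 * α) := by
          have : η ^ (2 * α) = (η ^ α) ^ 2 := by
            rw [← Real.rpow_mul_natCast hηpos.le]; congr 1; push_cast; ring
          rw [this, ← mul_pow]
          gcongr
          linarith
        have b2 : (N + 1) * (Real.pi * (2 * ε) ^ 2) ≤ Real.pi * (4 * (D + 1)) * η ^ (2 * α) := by
          have := Real.pi_pos
          have : (N + 1) * (Real.pi * (2 * ε) ^ 2) = Real.pi * 4 * (N * ε ^ 2 + ε ^ 2) := by ring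
          rw [this, show Real.pi * (4 * (D + 1)) * η ^ (2 * α) =
            Real.pi * 4 * (D * η ^ (2 * α) + η ^ (2 * α)) by ring]
          gcongr
        have b3 := mul_le_mul_of_nonneg_left b1 Real.pi_pos.le
        linarith

/-! ### The reciprocal Gamma function on the real line -/

/-- The entire function `1 / Γ`, restricted to `ℝ`; it vanishes at the poles of `Γ`. -/
noncomputable def recipGamma (x : ℝ) : ℝ := (Real.Gamma x)⁻¹

theorem contDiff_recipGamma : ContDiff ℝ 1 recipGamma := by
  have h : recipGamma = fun x : ℝ => ((Complex.Gamma (x : ℂ))⁻¹).re := by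
    funext x
    rw [Complex.Gamma_ofReal, ← Complex.ofReal_inv, Complex.ofReal_re, recipGamma]
  rw [h]
  have h1 : ContDiff ℝ 1 (fun z : ℂ => (Complex.Gamma z)⁻¹) :=
    (Complex.differentiable_one_div_Gamma.contDiff (n := 1)).restrict_scalars ℝ
  exact Complex.reCLM.contDiff.comp (h1.comp Complex.ofRealCLM.contDiff)

theorem hasDerivAt_recipGamma (x : ℝ) : HasDerivAt recipGamma (deriv recipGamma x) x :=
  (contDiff_recipGamma.differentiable one_ne_zero x).hasDerivAt

theorem recipGamma_eq_mul (x : ℝ) : recipGamma x = x * recipGamma (x + 1) := by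
  rcases eq_or_ne x 0 with rfl | hx
  · simp [recipGamma, Real.Gamma_zero]
  · rw [recipGamma, recipGamma, Real.Gamma_add_one hx, mul_inv, mul_inv_cancel_left₀ hx]

theorem deriv_recipGamma_eq (x : ℝ) :
    deriv recipGamma x = recipGamma (x + 1) + x * deriv recipGamma (x + 1) := by
  have h1 : HasDerivAt (fun y => y * recipGamma (y + 1))
      (1 * recipGamma (x + 1) + x * deriv recipGamma (x + 1)) x :=
    (hasDerivAt_id x).mul ((hasDerivAt_recipGamma (x + 1)).comp_add_const x 1)
  have h2 : recipGamma = fun y => y * recipGamma (y + 1) := funext recipGamma_eq_mul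
  rw [← h2, one_mul] at h1
  exact h1.deriv

/-- The recurrence for `1 / Γ` propagates bounds from a compact interval to a half-line. -/
theorem exists_recipGamma_bound (x₀ : ℝ) :
    ∃ B, ∀ x, x₀ ≤ x → |recipGamma x| ≤ B ∧ |deriv recipGamma x| ≤ B := by
  obtain ⟨B₁, h₁⟩ := (isCompact_Icc (a := min x₀ 2) (b := 3)).exists_bound_of_continuousOn
    contDiff_recipGamma.continuous.continuousOn
  obtain ⟨B₂, h₂⟩ := (isCompact_Icc (a := min x₀ 2) (b := 3)).exists_bound_of_continuousOn
    (contDiff_recipGamma.continuous_deriv le_rfl).continuousOn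
  have key : ∀ n : ℕ, ∀ x, min x₀ 2 ≤ x → x ≤ 3 + n →
      |recipGamma x| ≤ max B₁ B₂ ∧ |deriv recipGamma x| ≤ max B₁ B₂ := by
    intro n
    induction n with
    | zero =>
      intro x hx hx'
      have hm : x ∈ Icc (min x₀ 2) 3 := ⟨hx, by simpa using hx'⟩
      exact ⟨(h₁ x hm).trans (le_max_left _ _), (h₂ x hm).trans (le_max_right _ _)⟩
    | succ n ih =>
      intro x hx hx'
      push_cast at hx'
      rcases le_or_gt x (3 + n) with h | h
      · exact ih x hx h
      · have hz : 2 ≤ x - 1 := by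
          have : (0 : ℝ) ≤ n := n.cast_nonneg
          linarith
        obtain ⟨a1, a2⟩ := ih (x - 1) (le_trans (min_le_right _ _) hz) (by linarith)
        have e1 := recipGamma_eq_mul (x - 1)
        have e2 := deriv_recipGamma_eq (x - 1)
        rw [sub_add_cancel] at e1 e2
        rw [abs_le] at a1 a2
        -- both recurrences divide by a number that is at least `2`
        have b1 : |recipGamma x| * 2 ≤ |recipGamma (x - 1)| := by
          rw [e1, abs_mul, abs_of_nonneg (by linarith : (0 : ℝ) ≤ x - 1), mul_comm]
          exact mul_le_mul_of_nonneg_right hz (abs_nonneg _)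
        have b2 : |deriv recipGamma x| * 2 ≤ |deriv recipGamma (x - 1)| + |recipGamma x| := by
          have e3 : (x - 1) * deriv recipGamma x = deriv recipGamma (x - 1) - recipGamma x := by
            linarith
          calc |deriv recipGamma x| * 2 ≤ (x - 1) * |deriv recipGamma x| := by
                rw [mul_comm]; exact mul_le_mul_of_nonneg_right hz (abs_nonneg _)
            _ = |(x - 1) * deriv recipGamma x| := by
                rw [abs_mul, abs_of_nonneg (by linarith : (0 : ℝ) ≤ x - 1)]
            _ ≤ _ := by rw [e3]; exact abs_sub _ _
        have c1 := abs_le.2 a1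
        have c2 := abs_le.2 a2
        have := abs_nonneg (recipGamma x)
        constructor <;> linarith
  refine ⟨max B₁ B₂, fun x hx => ?_⟩
  obtain ⟨n, hn⟩ := exists_nat_ge x
  exact key n x ((min_le_left _ _).trans hx) (by linarith)

theorem recipGamma_ne_zero {x : ℝ} (hx : ∀ m : ℕ, x ≠ -m) : recipGamma x ≠ 0 :=
  inv_ne_zero (Real.Gamma_ne_zero hx)

theorem recipGamma_neg_nat (m : ℕ) : recipGamma (-m) = 0 := by
  rw [recipGamma, Real.Gamma_neg_nat_eq_zero, inv_zero]

/-- The zeros of `1 / Γ` are simple. -/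
theorem deriv_recipGamma_neg_nat_ne_zero (m : ℕ) : deriv recipGamma (-m) ≠ 0 := by
  induction m with
  | zero =>
    rw [deriv_recipGamma_eq]
    simp [recipGamma]
  | succ m ih =>
    rw [deriv_recipGamma_eq]
    have e : -((m + 1 : ℕ) : ℝ) + 1 = -m := by push_cast; ring
    rw [e, recipGamma_neg_nat, zero_add]
    exact mul_ne_zero (neg_ne_zero.2 (by positivity)) ih

/-! ### Entire power series -/

/-- The sum of the power series with coefficients `c`. -/
noncomputable def entireSeries (c : ℕ → ℝ) (z : ℝ) : ℝ := ∑' m, c m * z ^ m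

/-- The coefficients of the derivative of a power series. -/
def derivCoeff (c : ℕ → ℝ) (m : ℕ) : ℝ := (m + 1) * c (m + 1)

theorem derivCoeff_bound {c : ℕ → ℝ} {B : ℝ} (hc : ∀ m, |c m| ≤ B / m.factorial) (m : ℕ) :
    |derivCoeff c m| ≤ B / m.factorial := by
  have h := hc (m + 1)
  rw [derivCoeff, abs_mul, abs_of_nonneg (by positivity : (0 : ℝ) ≤ m + 1)]
  calc ((m : ℝ) + 1) * |c (m + 1)| ≤ (m + 1) * (B / (m + 1).factorial) := by gcongr
    _ = B / m.factorial := by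
      rw [Nat.factorial_succ]; push_cast; field_simp

theorem summable_bound (B r : ℝ) : Summable fun m : ℕ => B / m.factorial * r ^ m :=
  ((Real.summable_pow_div_factorial r).mul_left B).congr fun m => by ring

theorem summable_entireSeries {c : ℕ → ℝ} {B : ℝ} (hc : ∀ m, |c m| ≤ B / m.factorial) (z : ℝ) :
    Summable fun m => c m * z ^ m := by
  refine Summable.of_norm_bounded (summable_bound B |z|) fun m => ?_
  rw [Real.norm_eq_abs, abs_mul, abs_pow]
  exact mul_le_mul_of_nonneg_right (hc m) (by positivity)

theorem hasDerivAt_entireSeries {c : ℕ → ℝ} {B : ℝ} (hc : ∀ m, |c m| ≤ B / m.factorial) (z : ℝ) :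
    HasDerivAt (entireSeries c) (entireSeries (derivCoeff c) z) z := by
  set R : ℝ := |z| + 1 with hR
  have hRpos : 0 ≤ R := by positivity
  have hterm : ∀ (y : ℝ) (m : ℕ), c (m + 1) * (((m + 1 : ℕ) : ℝ) * y ^ (m + 1 - 1)) =
      derivCoeff c m * y ^ m := fun y m => by
    rw [derivCoeff, Nat.add_sub_cancel]; push_cast; ring
  have hu : Summable fun n : ℕ => B / n.factorial * (n * R ^ (n - 1)) := by
    rw [← summable_nat_add_iff 1]
    refine (summable_bound B R).congr fun n => ?_
    rw [Nat.factorial_succ, Nat.add_sub_cancel]; push_cast; field_simp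
  have hz : z ∈ Metric.ball (0 : ℝ) R := by simp [hR]
  have h := hasDerivAt_tsum_of_isPreconnected (g := fun n y => c n * y ^ n)
    (g' := fun n y => c n * (n * y ^ (n - 1))) hu Metric.isOpen_ball
    (convex_ball (0 : ℝ) R).isPreconnected
    (fun n y _ => (hasDerivAt_pow n y).const_mul (c n))
    (fun n y hy => by
      have hy : |y| ≤ R := by
        rw [mem_ball_zero_iff, Real.norm_eq_abs] at hy
        exact hy.le
      rw [Real.norm_eq_abs, abs_mul, abs_mul, abs_pow, Nat.abs_cast]
      have h1 := hc n
      have h2 : 0 ≤ B / n.factorial := (abs_nonneg _).trans h1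
      gcongr) hz (summable_entireSeries hc z) hz
  have hsum : Summable fun n : ℕ => c n * (n * z ^ (n - 1)) := by
    rw [← summable_nat_add_iff 1]
    refine (summable_entireSeries (derivCoeff_bound hc) z).congr fun m => (hterm z m).symm
  rw [hsum.tsum_eq_zero_add] at h
  simp only [hterm] at h
  exact h.congr_deriv (by simp [entireSeries])

theorem entireSeries_zero (c : ℕ → ℝ) : entireSeries c 0 = c 0 := by
  rw [entireSeries, tsum_eq_single 0 fun m hm => by simp [hm]]
  simp

/-- The operator `z P'' + (s + 1) P' + P` acting on a power series. -/
theorem entireSeries_besselOperator {c : ℕ → ℝ} {B : ℝ} (hc : ∀ m, |c m| ≤ B / m.factorial)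
    (s z : ℝ) :
    z * entireSeries (derivCoeff (derivCoeff c)) z + (s + 1) * entireSeries (derivCoeff c) z +
      entireSeries c z =
    entireSeries (fun m => (m + 1) * (m + s + 1) * c (m + 1) + c m) z := by
  have h1 := derivCoeff_bound hc
  have h2 := derivCoeff_bound h1
  have s0 := summable_entireSeries hc z
  have s1 := summable_entireSeries h1 z
  have s2 := summable_entireSeries h2 z
  have hshift : ∀ m : ℕ, ((m + 1 : ℕ) : ℝ) * derivCoeff c (m + 1) * z ^ (m + 1) =
      z * (derivCoeff (derivCoeff c) m * z ^ m) := fun m => by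
    simp only [derivCoeff]; push_cast; ring
  have s3 : Summable fun m : ℕ => (m : ℝ) * derivCoeff c m * z ^ m := by
    rw [← summable_nat_add_iff 1]
    exact (s2.mul_left z).congr fun m => (hshift m).symm
  have e3 : z * entireSeries (derivCoeff (derivCoeff c)) z =
      ∑' m : ℕ, (m : ℝ) * derivCoeff c m * z ^ m := by
    rw [s3.tsum_eq_zero_add]
    simp only [hshift]
    rw [tsum_mul_left]
    simp [entireSeries]
  rw [e3, entireSeries, entireSeries, ← tsum_mul_left,
    ← s3.tsum_add (s1.mul_left (s + 1)), ← (s3.add (s1.mul_left (s + 1))).tsum_add s0, entireSeries]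
  refine tsum_congr fun m => ?_
  simp only [derivCoeff]
  ring

/-! ### The Bessel equation -/

/-- The pair `(f, t f')` solves the Bessel equation of order `s` with source term `src`, written
with the Euler operator `t d/dt` as a first order system on `(0, ∞)`. -/
def SolvesBessel (s : ℝ) (src f h : ℝ → ℝ) : Prop :=
  ∀ t, 0 < t → HasDerivAt f (h t / t) t ∧ HasDerivAt h (((s ^ 2 - t ^ 2) * f t + src t) / t) t

theorem SolvesBessel.congr {s : ℝ} {src src' f f' h : ℝ → ℝ} (H : SolvesBessel s src f h)
    (hf : ∀ t, 0 < t → f' t = f t) (hsrc : ∀ t, 0 < t → src' t = src t) :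
    SolvesBessel s src' f' h := by
  intro t ht
  obtain ⟨h1, h2⟩ := H t ht
  refine ⟨h1.congr_of_eventuallyEq ?_, ?_⟩
  · filter_upwards [Ioi_mem_nhds ht] with u hu using hf u hu
  · rwa [hf t ht, hsrc t ht]

theorem SolvesBessel.add {s : ℝ} {src src' f f' h h' : ℝ → ℝ} (H : SolvesBessel s src f h)
    (H' : SolvesBessel s src' f' h') :
    SolvesBessel s (fun t => src t + src' t) (fun t => f t + f' t) (fun t => h t + h' t) := by
  intro t ht
  refine ⟨((H t ht).1.add (H' t ht).1).congr_deriv (by ring),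
    ((H t ht).2.add (H' t ht).2).congr_deriv (by ring)⟩

theorem SolvesBessel.const_mul {s : ℝ} {src f h : ℝ → ℝ} (H : SolvesBessel s src f h) (a : ℝ) :
    SolvesBessel s (fun t => a * src t) (fun t => a * f t) (fun t => a * h t) := by
  intro t ht
  exact ⟨((H t ht).1.const_mul a).congr_deriv (by ring),
    ((H t ht).2.const_mul a).congr_deriv (by ring)⟩

theorem SolvesBessel.neg_order {s : ℝ} {src f h : ℝ → ℝ} (H : SolvesBessel (-s) src f h) :
    SolvesBessel s src f h := by
  intro t ht
  simpa using H t ht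

/-- The Euler operator maps `(t/2) ^ s * P((t/2) ^ 2)` to a function of the same form, with
`s P(z) + 2 z P'(z)` in place of `P(z)`. -/
theorem hasDerivAt_frobenius {P : ℝ → ℝ} {P' t : ℝ} (ht : 0 < t) (s : ℝ)
    (hP : HasDerivAt P P' ((t / 2) ^ 2)) :
    HasDerivAt (fun t => (t / 2) ^ s * P ((t / 2) ^ 2))
      ((t / 2) ^ s * (s * P ((t / 2) ^ 2) + 2 * (t / 2) ^ 2 * P') / t) t := by
  have h0 : HasDerivAt (fun t : ℝ => t / 2) (1 / 2) t := (hasDerivAt_id t).div_const 2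
  have h1 := h0.rpow_const (p := s) (Or.inl (by positivity))
  have h2 : HasDerivAt (fun t : ℝ => (t / 2) ^ 2) (t / 2) t :=
    (h0.pow 2).congr_deriv (by push_cast; ring)
  refine (h1.mul (hP.comp t h2)).congr_deriv ?_
  rw [Real.rpow_sub_one (by positivity)]
  simp only [Function.comp_apply]
  field_simp

/-- Frobenius method: on `(t/2) ^ s * P((t/2) ^ 2)` the Bessel operator of order `s` acts as
`z P'' + (s + 1) P' + P` acts on `P`. -/
theorem solvesBessel_frobenius {c : ℕ → ℝ} {B : ℝ} (hc : ∀ m, |c m| ≤ B / m.factorial) (s : ℝ) :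
    SolvesBessel s
      (fun t => (t / 2) ^ s * t ^ 2 *
        entireSeries (fun m => (m + 1) * (m + s + 1) * c (m + 1) + c m) ((t / 2) ^ 2))
      (fun t => (t / 2) ^ s * entireSeries c ((t / 2) ^ 2))
      (fun t => (t / 2) ^ s * (s * entireSeries c ((t / 2) ^ 2) +
        2 * (t / 2) ^ 2 * entireSeries (derivCoeff c) ((t / 2) ^ 2))) := by
  intro t ht
  refine ⟨hasDerivAt_frobenius ht s (hasDerivAt_entireSeries hc _), ?_⟩
  have h1 := hasDerivAt_entireSeries hc ((t / 2) ^ 2)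
  have h2 := hasDerivAt_entireSeries (derivCoeff_bound hc) ((t / 2) ^ 2)
  refine (hasDerivAt_frobenius (P := fun z => s * entireSeries c z +
    2 * z * entireSeries (derivCoeff c) z) ht s ((h1.const_mul s).add
      (((hasDerivAt_id _).const_mul 2).mul h2))).congr_deriv ?_
  beta_reduce
  rw [← entireSeries_besselOperator hc s]
  field_simp
  ring

/-- Coefficients of the power series in `(t / 2) ^ 2` of `(t / 2) ^ (-s) * J_s(t)`. -/
noncomputable def besselCoeff (s : ℝ) (m : ℕ) : ℝ :=
  (-1) ^ m / m.factorial * recipGamma (m + s + 1)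

/-- The derivatives of the coefficients `besselCoeff s` with respect to the order `s`. -/
noncomputable def besselCoeffDeriv (s : ℝ) (m : ℕ) : ℝ :=
  (-1) ^ m / m.factorial * deriv recipGamma (m + s + 1)

theorem exists_besselCoeff_bound (s₀ : ℝ) : ∃ B, ∀ s, s₀ ≤ s → ∀ m : ℕ,
    |besselCoeff s m| ≤ B / m.factorial ∧ |besselCoeffDeriv s m| ≤ B / m.factorial := by
  obtain ⟨B, hB⟩ := exists_recipGamma_bound (s₀ + 1)
  refine ⟨B, fun s hs m => ?_⟩
  have hm : (0 : ℝ) ≤ m := m.cast_nonneg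
  obtain ⟨h1, h2⟩ := hB (m + s + 1) (by linarith)
  have e : |(-1 : ℝ) ^ m / m.factorial| = 1 / m.factorial := by
    rw [abs_div, abs_pow, abs_neg, abs_one, one_pow, Nat.abs_cast]
  rw [besselCoeff, besselCoeffDeriv, abs_mul, abs_mul, e]
  constructor
  · calc 1 / (m.factorial : ℝ) * |recipGamma (m + s + 1)| ≤ 1 / m.factorial * B := by gcongr
      _ = _ := by ring
  · calc 1 / (m.factorial : ℝ) * |deriv recipGamma (m + s + 1)| ≤ 1 / m.factorial * B := by gcongr
      _ = _ := by ring

theorem besselJ_eq {t : ℝ} (ht : 0 < t) (s : ℝ) :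
    besselJ s t = (t / 2) ^ s * entireSeries (besselCoeff s) ((t / 2) ^ 2) := by
  rw [besselJ, entireSeries, ← tsum_mul_left]
  refine tsum_congr fun m => ?_
  rw [Real.rpow_add (by positivity), Real.rpow_mul (by positivity), Real.rpow_two,
    Real.rpow_natCast, besselCoeff, recipGamma]
  ring

/-- The Euler derivative `t J_s'(t)`. -/
noncomputable def besselJEuler (s t : ℝ) : ℝ :=
  (t / 2) ^ s * (s * entireSeries (besselCoeff s) ((t / 2) ^ 2) +
    2 * (t / 2) ^ 2 * entireSeries (derivCoeff (besselCoeff s)) ((t / 2) ^ 2))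

theorem solvesBessel_besselJ (s : ℝ) :
    SolvesBessel s (fun _ => 0) (besselJ s) (besselJEuler s) := by
  obtain ⟨B, hB⟩ := exists_besselCoeff_bound s
  refine (solvesBessel_frobenius (fun m => (hB s le_rfl m).1) s).congr
    (fun t ht => besselJ_eq ht s) fun t _ => ?_
  have : (fun m : ℕ => ((m : ℝ) + 1) * (m + s + 1) * besselCoeff s (m + 1) + besselCoeff s m) =
      fun _ => 0 := by
    funext m
    have h := recipGamma_eq_mul (m + s + 1)
    have e : ((m + 1 : ℕ) : ℝ) + s + 1 = m + s + 1 + 1 := by push_cast; ring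
    rw [besselCoeff, besselCoeff, e, h, Nat.factorial_succ]
    push_cast
    field_simp
    ring
  rw [this]
  simp [entireSeries]

/-- The derivative of `J_s(t)` with respect to the order `s`. -/
noncomputable def besselJOrderDeriv (s t : ℝ) : ℝ :=
  Real.log (t / 2) * besselJ s t + (t / 2) ^ s * entireSeries (besselCoeffDeriv s) ((t / 2) ^ 2)

theorem hasDerivAt_besselJ_order {t : ℝ} (ht : 0 < t) (s : ℝ) :
    HasDerivAt (fun s => besselJ s t) (besselJOrderDeriv s t) s := by
  obtain ⟨B, hB⟩ := exists_besselCoeff_bound (s - 1)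
  set z : ℝ := (t / 2) ^ 2 with hz
  have hz0 : 0 ≤ z := by positivity
  have h1 : HasDerivAt (fun s => entireSeries (besselCoeff s) z)
      (entireSeries (besselCoeffDeriv s) z) s := by
    refine hasDerivAt_tsum_of_isPreconnected (g := fun n s => besselCoeff s n * z ^ n)
      (g' := fun n s => besselCoeffDeriv s n * z ^ n) (summable_bound B z)
      (isOpen_Ioi (a := s - 1)) isPreconnected_Ioi (fun n y _ => ?_) (fun n y hy => ?_)
      (show s ∈ Ioi (s - 1) by simp) (summable_entireSeries (fun m => (hB s (by linarith) m).1) z)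
      (show s ∈ Ioi (s - 1) by simp)
    · have : HasDerivAt (fun s : ℝ => recipGamma (n + s + 1)) (deriv recipGamma (n + y + 1)) y :=
        (HasDerivAt.comp y (h := fun s : ℝ => n + s + 1) (hasDerivAt_recipGamma (n + y + 1))
          (((hasDerivAt_id y).const_add (n : ℝ)).add_const 1)).congr_deriv (by ring)
      exact (this.const_mul ((-1 : ℝ) ^ n / n.factorial)).mul_const (z ^ n)
    · rw [Real.norm_eq_abs, abs_mul, abs_of_nonneg (by positivity : 0 ≤ z ^ n)]
      exact mul_le_mul_of_nonneg_right (hB y (le_of_lt hy) n).2 (by positivity)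
  have h2 : HasDerivAt (fun s : ℝ => (t / 2) ^ s) ((t / 2) ^ s * Real.log (t / 2)) s :=
    Real.hasStrictDerivAt_const_rpow (by positivity) s |>.hasDerivAt
  have h3 := h2.mul h1
  have e : (fun s => besselJ s t) = fun s => (t / 2) ^ s * entireSeries (besselCoeff s) z :=
    funext fun s => besselJ_eq ht s
  rw [e]
  refine h3.congr_deriv ?_
  rw [besselJOrderDeriv, besselJ_eq ht]
  ring

/-- Differentiating the Bessel equation in the order `s` gives the source term `2 s J_s`. -/
theorem exists_solvesBessel_besselJOrderDeriv (s : ℝ) :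
    ∃ h, SolvesBessel s (fun t => 2 * s * besselJ s t) (besselJOrderDeriv s) h := by
  obtain ⟨B, hB⟩ := exists_besselCoeff_bound s
  have H1 := solvesBessel_frobenius (fun m => (hB s le_rfl m).2) s
  have hcoef : (fun m : ℕ => ((m : ℝ) + 1) * (m + s + 1) * besselCoeffDeriv s (m + 1) +
      besselCoeffDeriv s m) = fun m => -derivCoeff (besselCoeff s) m := by
    funext m
    have h := deriv_recipGamma_eq (m + s + 1)
    have e : ((m + 1 : ℕ) : ℝ) + s + 1 = m + s + 1 + 1 := by push_cast; ring
    rw [derivCoeff, besselCoeffDeriv, besselCoeffDeriv, besselCoeff, e, h, Nat.factorial_succ]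
    push_cast
    field_simp
    ring
  have hneg : ∀ z, entireSeries (fun m => -derivCoeff (besselCoeff s) m) z =
      -entireSeries (derivCoeff (besselCoeff s)) z := fun z => by
    simp only [entireSeries, neg_mul, tsum_neg]
  have H2 : SolvesBessel s (fun t => 2 * besselJEuler s t)
      (fun t => Real.log (t / 2) * besselJ s t)
      (fun t => besselJ s t + Real.log (t / 2) * besselJEuler s t) := by
    intro t ht
    obtain ⟨a1, a2⟩ := solvesBessel_besselJ s t ht
    have hl : HasDerivAt (fun t : ℝ => Real.log (t / 2)) (1 / t) t :=
      (((hasDerivAt_id t).div_const 2).log (by simp; positivity)).congr_deriv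
        (by simp; field_simp)
    exact ⟨(hl.mul a1).congr_deriv (by ring),
      (a1.add (hl.mul a2)).congr_deriv (by ring)⟩
  refine ⟨_, (H2.add H1).congr (fun t _ => rfl) fun t ht => ?_⟩
  rw [hcoef, hneg, besselJ_eq ht, besselJEuler]
  ring

/-! ### The Bessel function of the second kind -/

theorem besselJ_neg_nat (n : ℕ) {t : ℝ} (ht : 0 < t) : besselJ (-n) t = (-1) ^ n * besselJ n t := by
  obtain ⟨B, hB⟩ := exists_besselCoeff_bound (-n)
  set z : ℝ := (t / 2) ^ 2 with hz
  have hv : 0 < t / 2 := by positivity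
  have hsum := summable_entireSeries (fun m => (hB (-n) le_rfl m).1) z
  have hshift : ∀ m : ℕ, besselCoeff (-n) (m + n) * z ^ (m + n) =
      (-1) ^ n * z ^ n * (besselCoeff n m * z ^ m) := fun m => by
    have g1 : recipGamma (((m + n : ℕ) : ℝ) + -n + 1) = (m.factorial : ℝ)⁻¹ := by
      rw [recipGamma, ← Real.Gamma_nat_eq_factorial]; congr 2; push_cast; ring
    have g2 : recipGamma ((m : ℝ) + n + 1) = ((m + n).factorial : ℝ)⁻¹ := by
      rw [recipGamma, ← Real.Gamma_nat_eq_factorial]; congr 2; push_cast; ring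
    rw [besselCoeff, besselCoeff, g1, g2]
    ring
  have hzero : ∑ m ∈ Finset.range n, besselCoeff (-n) m * z ^ m = 0 := by
    refine Finset.sum_eq_zero fun m hm => ?_
    have hm : m < n := Finset.mem_range.1 hm
    have e : (m : ℝ) + -n + 1 = -((n - 1 - m : ℕ) : ℝ) := by
      rw [Nat.cast_sub (by omega), Nat.cast_sub (by omega)]; push_cast; ring
    rw [besselCoeff, e, recipGamma_neg_nat]
    ring
  have hval : entireSeries (besselCoeff (-n)) z =
      (-1) ^ n * z ^ n * entireSeries (besselCoeff n) z := by
    rw [entireSeries, ← hsum.sum_add_tsum_nat_add n, hzero, zero_add]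
    simp only [hshift]
    rw [tsum_mul_left, entireSeries]
  have hpow : (t / 2) ^ (-(n : ℝ)) * z ^ n = (t / 2) ^ (n : ℝ) := by
    rw [Real.rpow_neg hv.le, Real.rpow_natCast, hz, ← pow_mul, two_mul, pow_add,
      inv_mul_cancel_left₀ (by positivity)]
  rw [besselJ_eq ht, besselJ_eq ht, hval, ← hpow]
  ring

theorem cos_nat_mul_pi_sq (n : ℕ) : Real.cos (n * Real.pi) ^ 2 = 1 := by
  rw [Real.cos_nat_mul_pi, ← pow_mul, mul_comm, pow_mul]; simp

/-- At an integer order the limit that defines `Y_n` is a quotient of derivatives in the order. -/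
theorem besselY_natCast (n : ℕ) {t : ℝ} (ht : 0 < t) :
    besselY n t = 1 / Real.pi *
      (besselJOrderDeriv n t + (-1) ^ n * besselJOrderDeriv (-n) t) := by
  have hpi := Real.pi_pos
  set ε : ℝ := (-1) ^ n with hε
  have hcos : Real.cos (n * Real.pi) = ε := Real.cos_nat_mul_pi n
  have hε2 : ε * ε = 1 := by rw [← hcos, ← sq]; exact cos_nat_mul_pi_sq n
  have hε0 : ε ≠ 0 := fun h => by rw [h] at hε2; simp at hε2
  have hsin : Real.sin (n * Real.pi) = 0 := Real.sin_nat_mul_pi n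
  have hlin : HasDerivAt (fun s : ℝ => s * Real.pi) Real.pi (n : ℝ) := hasDerivAt_mul_const _
  have hnum : HasDerivAt (fun s => besselJ s t * Real.cos (s * Real.pi) - besselJ (-s) t)
      (besselJOrderDeriv n t * ε + besselJOrderDeriv (-n) t) (n : ℝ) := by
    have a1 := (hasDerivAt_besselJ_order ht n).mul hlin.cos
    have a2 := (hasDerivAt_besselJ_order ht (-n)).comp (n : ℝ) (hasDerivAt_neg (n : ℝ))
    refine (a1.sub a2).congr_deriv ?_
    rw [hcos, hsin]; ring
  have hden : HasDerivAt (fun s : ℝ => Real.sin (s * Real.pi)) (ε * Real.pi) (n : ℝ) := by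
    have := hlin.sin
    rwa [hcos] at this
  have hq := (hasDerivAt_iff_tendsto_slope.1 hnum).div (hasDerivAt_iff_tendsto_slope.1 hden)
    (mul_ne_zero hε0 hpi.ne')
  have hlim : Tendsto (fun s => besselYQuot s t) (𝓝[≠] (n : ℝ))
      (𝓝 ((besselJOrderDeriv n t * ε + besselJOrderDeriv (-n) t) / (ε * Real.pi))) := by
    refine hq.congr' ?_
    filter_upwards [self_mem_nhdsWithin] with s hs
    have hs : s - n ≠ 0 := sub_ne_zero.2 hs
    simp only [Pi.div_apply, slope_def_field, besselYQuot]
    rw [hsin, hcos, besselJ_neg_nat n ht, ← hε, mul_comm ε, sub_self, sub_zero, sub_zero,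
      div_div_div_cancel_right₀ hs]
  rw [besselY, if_pos ⟨n, by simp⟩, hlim.limUnder_eq]
  have : (besselJOrderDeriv n t * ε + besselJOrderDeriv (-n) t) / (ε * Real.pi) =
      1 / Real.pi * (besselJOrderDeriv n t + (ε * ε) / ε * besselJOrderDeriv (-n) t / (ε * ε)) := by
    field_simp
  rw [this, mul_div_cancel_right₀ _ hε0, hε2, div_one]

theorem exists_solvesBessel_besselY {s : ℝ} (hs : 0 ≤ s) :
    ∃ h, SolvesBessel s (fun _ => 0) (besselY s) h := by
  by_cases hint : ∃ n : ℤ, s = n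
  · obtain ⟨n, rfl⟩ := hint
    obtain ⟨n, rfl⟩ := Int.eq_ofNat_of_zero_le (by exact_mod_cast hs : 0 ≤ n)
    obtain ⟨h₁, H₁⟩ := exists_solvesBessel_besselJOrderDeriv (n : ℝ)
    obtain ⟨h₂, H₂⟩ := exists_solvesBessel_besselJOrderDeriv (-(n : ℝ))
    refine ⟨_, ((H₁.add (H₂.neg_order.const_mul ((-1) ^ n))).const_mul (1 / Real.pi)).congr
      (fun t ht => ?_) fun t ht => ?_⟩
    · simpa using besselY_natCast n ht
    · rw [besselJ_neg_nat n ht]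
      have : ((-1 : ℝ) ^ n) * (-1) ^ n = 1 := by rw [← mul_pow]; simp
      linear_combination (2 * n * besselJ n t / Real.pi) * this
  · refine ⟨_, (((solvesBessel_besselJ s).const_mul (Real.cos (s * Real.pi) /
      Real.sin (s * Real.pi))).add ((solvesBessel_besselJ (-s)).neg_order.const_mul
      (-1 / Real.sin (s * Real.pi)))).congr (fun t _ => ?_) fun t _ => by simp⟩
    rw [besselY, if_neg hint, besselYQuot]
    ring

/-! ### Non-triviality of the Bessel functions -/

theorem tendsto_entireSeries_zero {c : ℕ → ℝ} {B : ℝ} (hc : ∀ m, |c m| ≤ B / m.factorial) :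
    Tendsto (fun t : ℝ => entireSeries c ((t / 2) ^ 2)) (𝓝[>] 0) (𝓝 (c 0)) := by
  have h1 : Tendsto (fun t : ℝ => (t / 2) ^ 2) (𝓝[>] 0) (𝓝 0) := by
    have : Tendsto (fun t : ℝ => (t / 2) ^ 2) (𝓝 0) (𝓝 ((0 / 2) ^ 2)) :=
      (by fun_prop : Continuous fun t : ℝ => (t / 2) ^ 2).tendsto 0
    simpa using this.mono_left nhdsWithin_le_nhds
  have h2 := (hasDerivAt_entireSeries hc 0).continuousAt.tendsto.comp h1
  rwa [entireSeries_zero] at h2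

theorem besselJ_nontrivial {s : ℝ} (hs : 0 ≤ s) : ∃ t, 0 < t ∧ besselJ s t ≠ 0 := by
  obtain ⟨B, hB⟩ := exists_besselCoeff_bound s
  have h0 : besselCoeff s 0 ≠ 0 := by
    have := recipGamma_ne_zero (x := s + 1) fun m => by
      have : (0 : ℝ) ≤ m := m.cast_nonneg
      linarith
    simpa [besselCoeff] using this
  have h := (tendsto_entireSeries_zero fun m => (hB s le_rfl m).1).eventually_ne h0
  obtain ⟨t, h1, h2⟩ := (h.and self_mem_nhdsWithin).exists
  have h2 : 0 < t := h2
  refine ⟨t, h2, ?_⟩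
  rw [besselJ_eq h2]
  exact mul_ne_zero (by positivity) h1

theorem tendsto_half_nhdsGT : Tendsto (fun t : ℝ => t / 2) (𝓝[>] 0) (𝓝[>] 0) := by
  refine tendsto_nhdsWithin_iff.2 ⟨?_, ?_⟩
  · have : Tendsto (fun t : ℝ => t / 2) (𝓝 0) (𝓝 (0 / 2)) :=
      (by fun_prop : Continuous fun t : ℝ => t / 2).tendsto 0
    simpa using this.mono_left nhdsWithin_le_nhds
  · filter_upwards [self_mem_nhdsWithin] with t ht
    have : 0 < t := ht
    exact half_pos this

theorem tendsto_half_rpow {s : ℝ} (hs : 0 < s) :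
    Tendsto (fun t : ℝ => (t / 2) ^ s) (𝓝[>] 0) (𝓝 0) := by
  have h := (Real.continuousAt_rpow_const 0 s (Or.inr hs.le)).tendsto
  rw [Real.zero_rpow hs.ne'] at h
  exact (h.mono_left nhdsWithin_le_nhds).comp tendsto_half_nhdsGT

theorem besselY_nontrivial {s : ℝ} (hs : 0 ≤ s) : ∃ t, 0 < t ∧ besselY s t ≠ 0 := by
  have hpi := Real.pi_pos
  obtain ⟨B, hB⟩ := exists_besselCoeff_bound (-s)
  have hP := tendsto_entireSeries_zero fun m => (hB s (by linarith) m).1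
  have hP' := tendsto_entireSeries_zero fun m => (hB (-s) le_rfl m).1
  have hR := tendsto_entireSeries_zero fun m => (hB s (by linarith) m).2
  have hR' := tendsto_entireSeries_zero fun m => (hB (-s) le_rfl m).2
  by_contra! hcon
  -- it is enough that some multiple of `Y_s` has a non-zero limit at `0`
  suffices h : ∃ (w : ℝ → ℝ) (l : ℝ), l ≠ 0 ∧
      Tendsto (fun t => w t * besselY s t) (𝓝[>] 0) (𝓝 l) by
    obtain ⟨w, l, hl, hlim⟩ := h
    refine hl (tendsto_nhds_unique hlim (tendsto_const_nhds.congr' ?_))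
    filter_upwards [self_mem_nhdsWithin] with t ht
    rw [hcon t ht, mul_zero]
  by_cases hint : ∃ n : ℤ, s = n
  · obtain ⟨n, rfl⟩ := hint
    obtain ⟨n, rfl⟩ := Int.eq_ofNat_of_zero_le (by exact_mod_cast hs : 0 ≤ n)
    simp only [Int.cast_natCast] at *
    have hε : ((-1 : ℝ) ^ n) * (-1) ^ n = 1 := by rw [← mul_pow]; simp
    have hY : ∀ t, 0 < t → Real.pi * (t / 2) ^ (n : ℝ) * besselY n t =
        2 * (Real.log (t / 2) * ((t / 2) ^ (n : ℝ) * (t / 2) ^ (n : ℝ))) *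
          entireSeries (besselCoeff n) ((t / 2) ^ 2) +
        (t / 2) ^ (n : ℝ) * (t / 2) ^ (n : ℝ) *
          entireSeries (besselCoeffDeriv n) ((t / 2) ^ 2) +
        (-1) ^ n * entireSeries (besselCoeffDeriv (-n)) ((t / 2) ^ 2) := fun t ht => by
      have hv : 0 < t / 2 := by positivity
      have e : (t / 2) ^ (n : ℝ) * (t / 2) ^ (-(n : ℝ)) = 1 := by
        rw [← Real.rpow_add hv]; simp
      rw [besselY_natCast n ht, besselJOrderDeriv, besselJOrderDeriv, besselJ_neg_nat n ht,
        besselJ_eq ht]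
      generalize (t / 2) ^ 2 = z
      field_simp
      linear_combination ((-1) ^ n * entireSeries (besselCoeffDeriv (-n)) z) * e +
        ((t / 2) ^ (n : ℝ) * (t / 2) ^ (n : ℝ) * Real.log (t / 2) *
          entireSeries (besselCoeff n) z) * hε
    rcases Nat.eq_zero_or_pos n with rfl | hn
    · -- `Y_0` has a logarithmic singularity
      have hlog : Tendsto (fun t : ℝ => (Real.log (t / 2))⁻¹) (𝓝[>] 0) (𝓝 0) :=
        (Real.tendsto_log_nhdsGT_zero.comp tendsto_half_nhdsGT).inv_tendsto_atBot
      refine ⟨fun t => (Real.log (t / 2))⁻¹ * (Real.pi * (t / 2) ^ ((0 : ℕ) : ℝ)),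
        2 * besselCoeff (0 : ℕ) 0 + 0 * (besselCoeffDeriv (0 : ℕ) 0 +
          besselCoeffDeriv (-(0 : ℕ)) 0), ?_, ?_⟩
      · simp [besselCoeff, recipGamma]
      · refine ((hP.const_mul 2).add (hlog.mul (hR.add hR'))).congr' ?_
        filter_upwards [self_mem_nhdsWithin,
          mem_nhdsWithin_of_mem_nhds (Iio_mem_nhds (zero_lt_two (α := ℝ)))] with t ht ht2
        have ht : 0 < t := ht
        have ht2 : t < 2 := ht2
        have hl : Real.log (t / 2) ≠ 0 :=
          (Real.log_neg (by positivity) (by linarith)).ne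
        rw [mul_assoc, hY t ht]
        generalize (t / 2) ^ 2 = z
        simp
        field_simp
        ring
    · have hn' : (0 : ℝ) < n := by exact_mod_cast hn
      have hpow := tendsto_half_rpow hn'
      have hlog : Tendsto (fun t : ℝ => Real.log (t / 2) * (t / 2) ^ (n : ℝ)) (𝓝[>] 0) (𝓝 0) :=
        (tendsto_log_mul_rpow_nhdsGT_zero hn').comp tendsto_half_nhdsGT
      refine ⟨fun t => Real.pi * (t / 2) ^ (n : ℝ), (-1) ^ n * besselCoeffDeriv (-n) 0, ?_, ?_⟩
      · refine mul_ne_zero (by simp) ?_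
        have e : (((0 : ℕ) : ℝ) + -n + 1) = -((n - 1 : ℕ) : ℝ) := by
          rw [Nat.cast_sub hn]; push_cast; ring
        rw [besselCoeffDeriv, e]
        simpa using deriv_recipGamma_neg_nat_ne_zero (n - 1)
      · have h := ((((hlog.mul hpow).const_mul 2).mul hP).add
          ((hpow.mul hpow).mul hR)).add (hR'.const_mul ((-1) ^ n))
        simp only [mul_zero, zero_mul, zero_add] at h
        refine h.congr' ?_
        filter_upwards [self_mem_nhdsWithin] with t ht
        rw [hY t ht]
        ring
  · -- `J_{-s}` is unbounded at the origin and `J_s` is bounded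
    have hs0 : 0 < s := lt_of_le_of_ne hs fun h => hint ⟨0, by simp [← h]⟩
    have hsin : Real.sin (s * Real.pi) ≠ 0 := by
      rw [Ne, Real.sin_eq_zero_iff]
      rintro ⟨k, hk⟩
      exact hint ⟨k, (mul_right_cancel₀ hpi.ne' hk).symm⟩
    refine ⟨fun t => (t / 2) ^ s * Real.sin (s * Real.pi),
      0 * 0 * besselCoeff s 0 * Real.cos (s * Real.pi) - besselCoeff (-s) 0, ?_, ?_⟩
    · have := recipGamma_ne_zero (x := -s + 1) fun m h => hint ⟨m + 1, by push_cast; linarith⟩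
      simpa [besselCoeff] using this
    · have hpow := tendsto_half_rpow hs0
      refine ((((hpow.mul hpow).mul hP).mul_const _).sub hP').congr' ?_
      filter_upwards [self_mem_nhdsWithin] with t ht
      have ht : 0 < t := ht
      have e : (t / 2) ^ s * (t / 2) ^ (-s) = 1 := by
        rw [← Real.rpow_add (by positivity)]; simp
      rw [besselY, if_neg hint, besselYQuot, besselJ_eq ht, besselJ_eq ht]
      generalize (t / 2) ^ 2 = z
      field_simp
      linear_combination entireSeries (besselCoeff (-s)) z * e

/-! ### The equation of the generalized Bessel functions -/

/-- `x' = y` and `x'' + (2α/t) x' + (1 - κ/t²) x = 0` on `(0, ∞)`. -/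
def SolvesPhase (α κ : ℝ) (x y : ℝ → ℝ) : Prop :=
  ∀ t, 0 < t → HasDerivAt x (y t) t ∧
    HasDerivAt y (-(2 * α / t) * y t - (1 - κ / t ^ 2) * x t) t

/-- The substitution `x = t^a f` turns the Bessel equation into the equation of the phase curve. -/
theorem SolvesBessel.solvesPhase {s a κ : ℝ} {f h : ℝ → ℝ} (hs : s ^ 2 = a ^ 2 + κ)
    (H : SolvesBessel s (fun _ => 0) f h) :
    SolvesPhase (1 / 2 - a) κ (fun t => t ^ a * f t) (fun t => t ^ (a - 1) * (a * f t + h t)) := by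
  intro t ht
  obtain ⟨h1, h2⟩ := H t ht
  have p1 := Real.hasDerivAt_rpow_const (x := t) (p := a) (Or.inl ht.ne')
  have p2 := Real.hasDerivAt_rpow_const (x := t) (p := a - 1) (Or.inl ht.ne')
  refine ⟨(p1.mul h1).congr_deriv ?_, (p2.mul ((h1.const_mul a).add h2)).congr_deriv ?_⟩
  · simp only [Real.rpow_sub_one ht.ne']
    field_simp
  · simp only [Real.rpow_sub_one ht.ne', hs, Pi.add_apply]
    field_simp
    ring

theorem exists_solvesPhase_genBessel {μ ν : ℝ} {x : ℝ → ℝ}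
    (hx : x = genBesselJ ν μ ∨ x = genBesselY ν μ) :
    ∃ y, SolvesPhase ((2 - μ) / 2) (ν ^ 2) x y ∧ ∃ t, 0 < t ∧ x t ≠ 0 := by
  have hs0 : 0 ≤ besselOrder ν μ := Real.sqrt_nonneg _
  have hs : besselOrder ν μ ^ 2 = ((μ - 1) / 2) ^ 2 + ν ^ 2 := Real.sq_sqrt (by positivity)
  have e : (2 - μ) / 2 = 1 / 2 - (μ - 1) / 2 := by ring
  rw [e]
  rcases hx with rfl | rfl
  · obtain ⟨t, ht, h⟩ := besselJ_nontrivial hs0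
    exact ⟨_, (solvesBessel_besselJ _).solvesPhase hs, t, ht,
      mul_ne_zero (Real.rpow_pos_of_pos ht _).ne' h⟩
  · obtain ⟨t, ht, h⟩ := besselY_nontrivial hs0
    obtain ⟨k, hk⟩ := exists_solvesBessel_besselY hs0
    exact ⟨_, hk.solvesPhase hs, t, ht, mul_ne_zero (Real.rpow_pos_of_pos ht _).ne' h⟩

/-! ### Energy estimate -/

theorem monotoneOn_of_hasDerivAt {f f' : ℝ → ℝ} {D : Set ℝ} (hD : Convex ℝ D)
    (h : ∀ t ∈ D, HasDerivAt f (f' t) t) (h0 : ∀ t ∈ D, 0 ≤ f' t) : MonotoneOn f D :=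
  monotoneOn_of_deriv_nonneg hD (fun t ht => (h t ht).continuousAt.continuousWithinAt)
    (fun t ht => (h t (interior_subset ht)).differentiableAt.differentiableWithinAt)
    fun t ht => by rw [(h t (interior_subset ht)).deriv]; exact h0 t (interior_subset ht)

theorem antitoneOn_of_hasDerivAt {f f' : ℝ → ℝ} {D : Set ℝ} (hD : Convex ℝ D)
    (h : ∀ t ∈ D, HasDerivAt f (f' t) t) (h0 : ∀ t ∈ D, f' t ≤ 0) : AntitoneOn f D := by
  have := monotoneOn_of_hasDerivAt hD (fun t ht => (h t ht).neg) (fun t ht => by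
    have := h0 t ht
    linarith)
  intro s hs t ht hst
  exact neg_le_neg_iff.1 (this hs ht hst)

/-- The energy `u² + u'²` of `u = t^α x`, which satisfies `u'' + (1 - c/t²) u = 0`. -/
noncomputable def energy (α : ℝ) (x y : ℝ → ℝ) (t : ℝ) : ℝ :=
  (t ^ α * x t) ^ 2 + (t ^ α * (y t + α / t * x t)) ^ 2

theorem SolvesPhase.hasDerivAt_energy {α κ : ℝ} {x y : ℝ → ℝ} (H : SolvesPhase α κ x y) {t : ℝ}
    (ht : 0 < t) : HasDerivAt (energy α x y)
      (2 * ((κ + α ^ 2 - α) / t ^ 2) * ((t ^ α * x t) * (t ^ α * (y t + α / t * x t)))) t := by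
  obtain ⟨h1, h2⟩ := H t ht
  have p := Real.hasDerivAt_rpow_const (x := t) (p := α) (Or.inl ht.ne')
  have q : HasDerivAt (fun t : ℝ => α / t) (-α / t ^ 2) t :=
    ((hasDerivAt_inv ht.ne').const_mul α).congr_deriv (by ring)
  have hu := (p.mul h1).pow 2
  have hv := (p.mul (h2.add (q.mul h1))).pow 2
  refine (hu.add hv).congr_deriv ?_
  simp only [Real.rpow_sub_one ht.ne', Pi.mul_apply, Pi.add_apply, Nat.add_one_sub_one, pow_one,
    Nat.cast_ofNat]
  field_simp
  ring

/-- The logarithmic derivative of the energy is at most `|c| / t²`, with `c = κ + α² - α`. -/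
theorem SolvesPhase.energy_bounds {α κ : ℝ} {x y : ℝ → ℝ} (H : SolvesPhase α κ x y) {s t : ℝ}
    (hs : 0 < s) (hst : s ≤ t) :
    energy α x y s * Real.exp (-|κ + α ^ 2 - α| / s) ≤
      energy α x y t * Real.exp (-|κ + α ^ 2 - α| / t) ∧
    energy α x y t * Real.exp (|κ + α ^ 2 - α| / t) ≤
      energy α x y s * Real.exp (|κ + α ^ 2 - α| / s) := by
  set c := κ + α ^ 2 - α with hc
  have hq : ∀ a t : ℝ, 0 < t → HasDerivAt (fun t : ℝ => Real.exp (a / t))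
      (Real.exp (a / t) * (-a / t ^ 2)) t := fun a t ht =>
    HasDerivAt.exp (((hasDerivAt_inv ht.ne').const_mul a).congr_deriv (by ring))
  have hb : ∀ t : ℝ, 0 < t → |2 * (c / t ^ 2) * ((t ^ α * x t) * (t ^ α * (y t + α / t * x t)))| ≤
      |c| / t ^ 2 * energy α x y t := fun t ht => by
    rw [energy]
    generalize t ^ α * x t = u
    generalize t ^ α * (y t + α / t * x t) = v
    have h1 : |2 * (u * v)| ≤ u ^ 2 + v ^ 2 := abs_le.2 ⟨by nlinarith [sq_nonneg (u + v)],
      by nlinarith [sq_nonneg (u - v)]⟩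
    have h2 : 2 * (c / t ^ 2) * (u * v) = c / t ^ 2 * (2 * (u * v)) := by ring
    rw [h2, abs_mul, abs_div, abs_of_pos (by positivity : 0 < t ^ 2)]
    gcongr
  have hpos : ∀ t : ℝ, t ∈ Ici s → 0 < t := fun t ht => hs.trans_le ht
  constructor
  · refine monotoneOn_of_hasDerivAt (convex_Ici s)
      (fun t ht => (H.hasDerivAt_energy (hpos t ht)).mul (hq (-|c|) t (hpos t ht)))
      (fun t ht => ?_) self_mem_Ici hst hst
    have h1 := neg_le_of_abs_le (hb t (hpos t ht))
    have h2 := Real.exp_pos (-|c| / t)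
    rw [show ∀ A E : ℝ, A * Real.exp (-|c| / t) + E * (Real.exp (-|c| / t) * (-(-|c|) / t ^ 2)) =
      Real.exp (-|c| / t) * (A + |c| / t ^ 2 * E) from fun A E => by ring]
    exact mul_nonneg h2.le (by linarith)
  · refine antitoneOn_of_hasDerivAt (convex_Ici s)
      (fun t ht => (H.hasDerivAt_energy (hpos t ht)).mul (hq |c| t (hpos t ht)))
      (fun t ht => ?_) self_mem_Ici hst hst
    have h1 := le_of_abs_le (hb t (hpos t ht))
    have h2 := Real.exp_pos (|c| / t)
    rw [show ∀ A E : ℝ, A * Real.exp (|c| / t) + E * (Real.exp (|c| / t) * (-|c| / t ^ 2)) =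
      Real.exp (|c| / t) * (A - |c| / t ^ 2 * E) from fun A E => by ring]
    exact mul_nonpos_of_nonneg_of_nonpos h2.le (by linarith)

theorem energy_nonneg (α : ℝ) (x y : ℝ → ℝ) (t : ℝ) : 0 ≤ energy α x y t := by
  rw [energy]; positivity

/-- A solution that does not vanish identically has no zero in the phase plane. -/
theorem SolvesPhase.energy_pos {α κ : ℝ} {x y : ℝ → ℝ} (H : SolvesPhase α κ x y) {t₀ : ℝ}
    (ht₀ : 0 < t₀) (hx : x t₀ ≠ 0) {t : ℝ} (ht : 0 < t) : 0 < energy α x y t := by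
  have h0 : 0 < energy α x y t₀ := by
    have : 0 < (t₀ ^ α * x t₀) ^ 2 := by positivity
    rw [energy]; positivity
  refine lt_of_le_of_ne (energy_nonneg _ _ _ _) fun h => ?_
  rcases le_total t₀ t with h1 | h1
  · have h2 := (H.energy_bounds ht₀ h1).1
    rw [← h, zero_mul] at h2
    exact absurd h2 (not_le.2 (by positivity))
  · have h2 := (H.energy_bounds ht h1).2
    rw [← h, zero_mul] at h2
    exact absurd h2 (not_le.2 (by positivity))

theorem SolvesPhase.sq_add_sq_pos {α κ : ℝ} {x y : ℝ → ℝ} (H : SolvesPhase α κ x y) {t₀ : ℝ}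
    (ht₀ : 0 < t₀) (hx : x t₀ ≠ 0) {t : ℝ} (ht : 0 < t) : 0 < x t ^ 2 + y t ^ 2 := by
  refine lt_of_le_of_ne (by positivity) fun h => ?_
  have h1 : x t = 0 := by nlinarith [sq_nonneg (x t), sq_nonneg (y t)]
  have h2 : y t = 0 := by nlinarith [sq_nonneg (x t), sq_nonneg (y t)]
  have := H.energy_pos ht₀ hx ht
  rw [energy, h1, h2] at this
  simp at this

theorem SolvesPhase.exists_radius_bounds {α κ : ℝ} {x y : ℝ → ℝ} (H : SolvesPhase α κ x y)
    {t₀ : ℝ} (ht₀ : 0 < t₀) (hx : x t₀ ≠ 0) {τ : ℝ} (hτ : 0 < τ) :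
    ∃ A B : ℝ, 0 < A ∧ 0 < B ∧ ∀ t ∈ Ici τ,
      A * t ^ (-α) ≤ Real.sqrt (x t ^ 2 + y t ^ 2) ∧
      Real.sqrt (x t ^ 2 + y t ^ 2) ≤ B * t ^ (-α) := by
  set c := |κ + α ^ 2 - α| with hc
  set k : ℝ := 2 + 2 * (α / τ) ^ 2 with hk
  have hkpos : 0 < k := by positivity
  have hE := H.energy_pos ht₀ hx hτ
  set A : ℝ := energy α x y τ * Real.exp (-c / τ) / k with hA
  set B : ℝ := energy α x y τ * Real.exp (c / τ) * k with hB
  have hApos : 0 < A := by positivity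
  have hBpos : 0 < B := by positivity
  refine ⟨Real.sqrt A, Real.sqrt B, Real.sqrt_pos.2 hApos, Real.sqrt_pos.2 hBpos, fun t ht => ?_⟩
  have ht : τ ≤ t := ht
  have ht0 : 0 < t := hτ.trans_le ht
  obtain ⟨b1, b2⟩ := H.energy_bounds hτ ht
  have c1 : energy α x y τ * Real.exp (-c / τ) ≤ energy α x y t := by
    refine b1.trans (mul_le_of_le_one_right (energy_nonneg _ _ _ _) (Real.exp_le_one_iff.2 ?_))
    rw [neg_div]; exact neg_nonpos.2 (by positivity)
  have c2 : energy α x y t ≤ energy α x y τ * Real.exp (c / τ) :=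
    (le_mul_of_one_le_right (energy_nonneg _ _ _ _) (Real.one_le_exp (by positivity))).trans b2
  have hq : (α / t) ^ 2 ≤ (α / τ) ^ 2 := by
    rw [div_pow, div_pow]; gcongr
  have hEt : energy α x y t = (t ^ α) ^ 2 * (x t ^ 2 + (y t + α / t * x t) ^ 2) := by
    rw [energy]; ring
  have d1 : energy α x y t ≤ (t ^ α) ^ 2 * (k * (x t ^ 2 + y t ^ 2)) := by
    rw [hEt]
    have : (α / t * x t) ^ 2 ≤ (α / τ) ^ 2 * x t ^ 2 := by rw [mul_pow]; gcongr
    gcongr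
    nlinarith [sq_nonneg (y t - α / t * x t), sq_nonneg (α / τ * y t), sq_nonneg (x t)]
  have d2 : (t ^ α) ^ 2 * (x t ^ 2 + y t ^ 2) ≤ k * energy α x y t := by
    rw [hEt, mul_left_comm]
    have h1 : (α / t * x t) ^ 2 ≤ (α / τ) ^ 2 * x t ^ 2 := by rw [mul_pow]; gcongr
    gcongr
    nlinarith [sq_nonneg (y t + 2 * (α / t * x t)), sq_nonneg (α / τ * (y t + α / t * x t)),
      sq_nonneg (x t)]
  have hp : (t ^ (-α)) ^ 2 * (t ^ α) ^ 2 = 1 := by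
    rw [← mul_pow, ← Real.rpow_add ht0]; simp
  have hn : 0 ≤ t ^ (-α) := by positivity
  constructor
  · refine Real.le_sqrt_of_sq_le ?_
    rw [mul_pow, Real.sq_sqrt hApos.le, hA, div_mul_eq_mul_div, div_le_iff₀ hkpos]
    calc energy α x y τ * Real.exp (-c / τ) * (t ^ (-α)) ^ 2
        ≤ (t ^ α) ^ 2 * (k * (x t ^ 2 + y t ^ 2)) * (t ^ (-α)) ^ 2 :=
          mul_le_mul_of_nonneg_right (c1.trans d1) (by positivity)
      _ = ((t ^ (-α)) ^ 2 * (t ^ α) ^ 2) * ((x t ^ 2 + y t ^ 2) * k) := by ring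
      _ = _ := by rw [hp, one_mul]
  · refine Real.sqrt_le_iff.2 ⟨by positivity, ?_⟩
    rw [mul_pow, Real.sq_sqrt hBpos.le, hB]
    calc x t ^ 2 + y t ^ 2
        = ((t ^ (-α)) ^ 2 * (t ^ α) ^ 2) * (x t ^ 2 + y t ^ 2) := by rw [hp, one_mul]
      _ = (t ^ (-α)) ^ 2 * ((t ^ α) ^ 2 * (x t ^ 2 + y t ^ 2)) := by ring
      _ ≤ (t ^ (-α)) ^ 2 * (k * (energy α x y τ * Real.exp (c / τ))) := by
          exact mul_le_mul_of_nonneg_left (d2.trans (mul_le_mul_of_nonneg_left c2 hkpos.le))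
            (by positivity)
      _ = _ := by ring

/-! ### Polar coordinates in the phase plane -/

/-- The Prüfer equations: polar coordinates of the phase point of a solution of
`x'' + (2α/t) x' + (1 - κ/t²) x = 0`. -/
structure PruferPair (α κ : ℝ) (r θ : ℝ → ℝ) : Prop where
  pos : ∀ t, 0 < t → 0 < r t
  angle : ∀ t, 0 < t → HasDerivAt θ (-1 - 2 * α / t * (Real.sin (θ t) * Real.cos (θ t)) +
    κ / t ^ 2 * Real.cos (θ t) ^ 2) t
  radius : ∀ t, 0 < t → HasDerivAt r (r t * (Real.sin (θ t) *
    (-(2 * α / t) * Real.sin (θ t) + κ / t ^ 2 * Real.cos (θ t)))) t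

theorem SolvesPhase.exists_pruferPair {α κ : ℝ} {x y : ℝ → ℝ} (H : SolvesPhase α κ x y)
    (hne : ∀ t, 0 < t → 0 < x t ^ 2 + y t ^ 2) :
    ∃ θ, PruferPair α κ (fun t => Real.sqrt (x t ^ 2 + y t ^ 2)) θ ∧
      ∀ t, 0 < t → x t = Real.sqrt (x t ^ 2 + y t ^ 2) * Real.cos (θ t) ∧
        y t = Real.sqrt (x t ^ 2 + y t ^ 2) * Real.sin (θ t) := by
  set r : ℝ → ℝ := fun t => Real.sqrt (x t ^ 2 + y t ^ 2) with hr
  have hrpos : ∀ t, 0 < t → 0 < r t := fun t ht => Real.sqrt_pos.2 (hne t ht)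
  have hrsq : ∀ t, 0 < t → r t ^ 2 = x t ^ 2 + y t ^ 2 := fun t ht => Real.sq_sqrt (hne t ht).le
  set y' : ℝ → ℝ := fun t => -(2 * α / t) * y t - (1 - κ / t ^ 2) * x t with hy'
  set w : ℝ → ℝ := fun t => (x t * y' t - y t ^ 2) / (x t ^ 2 + y t ^ 2) with hw
  have hyd : ∀ t, 0 < t → HasDerivAt y (y' t) t := fun t ht => (H t ht).2
  have hxc : ContinuousOn x (Ioi 0) := fun t ht => (H t ht).1.continuousAt.continuousWithinAt
  have hyc : ContinuousOn y (Ioi 0) := fun t ht => (H t ht).2.continuousAt.continuousWithinAt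
  have hwc : ContinuousOn w (Ioi 0) := by
    have h0 : ∀ t ∈ Ioi (0 : ℝ), t ≠ 0 := fun t ht => ne_of_gt ht
    have hy'c : ContinuousOn y' (Ioi 0) :=
      (((continuousOn_const.div continuousOn_id h0).neg).mul hyc).sub
        ((continuousOn_const.sub (continuousOn_const.div (continuousOn_id.pow 2)
          fun t ht => pow_ne_zero 2 (h0 t ht))).mul hxc)
    exact ((hxc.mul hy'c).sub (hyc.pow 2)).div ((hxc.pow 2).add (hyc.pow 2))
      fun t ht => (hne t ht).ne'
  set z : ℂ := ⟨x 1, y 1⟩ with hz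
  set θ : ℝ → ℝ := fun t => Complex.arg z + ∫ u in (1 : ℝ)..t, w u with hθ
  have hθd : ∀ t, 0 < t → HasDerivAt θ (w t) t := fun t ht => by
    have hsub : uIcc 1 t ⊆ Ioi 0 := fun u hu => by
      rcases mem_uIcc.1 hu with h | h
      · exact lt_of_lt_of_le one_pos h.1
      · exact lt_of_lt_of_le ht h.1
    exact (intervalIntegral.integral_hasDerivAt_right (hwc.mono hsub).intervalIntegrable
      (hwc.stronglyMeasurableAtFilter isOpen_Ioi t ht)
      (hwc.continuousAt (Ioi_mem_nhds ht))).const_add _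
  have hrd : ∀ t, 0 < t → HasDerivAt r ((x t * y t + y t * y' t) / r t) t := fun t ht => by
    have h := (((H t ht).1.pow 2).add ((hyd t ht).pow 2)).sqrt (hne t ht).ne'
    refine h.congr_deriv ?_
    have e : Real.sqrt (((x ^ 2 + y ^ 2) : ℝ → ℝ) t) = r t := rfl
    rw [e]
    have := (hrpos t ht).ne'
    field_simp
    push_cast
    ring
  -- rotating the phase point by `-θ` and dividing by `r` gives a constant
  have hP : ∀ t, 0 < t → HasDerivAt (fun t => (x t * Real.cos (θ t) + y t * Real.sin (θ t)) / r t)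
      0 t := fun t ht => by
    have h := (((H t ht).1.mul (hθd t ht).cos).add ((hyd t ht).mul (hθd t ht).sin)).div (hrd t ht)
      (hrpos t ht).ne'
    refine h.congr_deriv ?_
    have h1 := (hrpos t ht).ne'
    have h2 := (hne t ht).ne'
    simp only [hw, Pi.add_apply, Pi.mul_apply]
    rw [← hrsq t ht] at h2 ⊢
    field_simp
    rw [hrsq t ht]
    ring
  have hQ : ∀ t, 0 < t → HasDerivAt (fun t => (y t * Real.cos (θ t) - x t * Real.sin (θ t)) / r t)
      0 t := fun t ht => by
    have h := (((hyd t ht).mul (hθd t ht).cos).sub ((H t ht).1.mul (hθd t ht).sin)).div (hrd t ht)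
      (hrpos t ht).ne'
    refine h.congr_deriv ?_
    have h1 := (hrpos t ht).ne'
    have h2 := (hne t ht).ne'
    simp only [hw, Pi.sub_apply, Pi.mul_apply]
    rw [← hrsq t ht] at h2 ⊢
    field_simp
    rw [hrsq t ht]
    ring
  have hconst : ∀ f : ℝ → ℝ, (∀ t, 0 < t → HasDerivAt f 0 t) → ∀ t, 0 < t → f t = f 1 :=
    fun f hf t ht => isOpen_Ioi.is_const_of_deriv_eq_zero isPreconnected_Ioi
      (fun u hu => (hf u hu).differentiableAt.differentiableWithinAt) (fun u hu => (hf u hu).deriv)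
      ht (mem_Ioi.2 one_pos)
  have hnz : ‖z‖ = r 1 := by rw [Complex.norm_eq_sqrt_sq_add_sq]
  have hθ1 : θ 1 = Complex.arg z := by simp [hθ]
  have hx1 : x 1 = r 1 * Real.cos (θ 1) := by
    rw [hθ1, ← hnz, Complex.norm_mul_cos_arg]
  have hy1 : y 1 = r 1 * Real.sin (θ 1) := by
    rw [hθ1, ← hnz, Complex.norm_mul_sin_arg]
  have hr1 := (hrpos 1 one_pos).ne'
  have hpol : ∀ t, 0 < t → x t = r t * Real.cos (θ t) ∧ y t = r t * Real.sin (θ t) := by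
    intro t ht
    have h1 := hconst _ hP t ht
    have h2 := hconst _ hQ t ht
    have h3 := (hrpos t ht).ne'
    have e1 : (x 1 * Real.cos (θ 1) + y 1 * Real.sin (θ 1)) / r 1 = 1 := by
      rw [hx1, hy1, div_eq_one_iff_eq hr1]
      linear_combination r 1 * Real.sin_sq_add_cos_sq (θ 1)
    have e2 : (y 1 * Real.cos (θ 1) - x 1 * Real.sin (θ 1)) / r 1 = 0 := by
      rw [hx1, hy1]; ring
    rw [e1, div_eq_one_iff_eq h3] at h1
    rw [e2, div_eq_zero_iff, or_iff_left h3] at h2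
    constructor
    · linear_combination Real.cos (θ t) * h1 - Real.sin (θ t) * h2 -
        x t * Real.sin_sq_add_cos_sq (θ t)
    · linear_combination Real.sin (θ t) * h1 + Real.cos (θ t) * h2 -
        y t * Real.sin_sq_add_cos_sq (θ t)
  refine ⟨θ, ⟨hrpos, fun t ht => (hθd t ht).congr_deriv ?_, fun t ht => (hrd t ht).congr_deriv ?_⟩,
    hpol⟩
  · obtain ⟨h1, h2⟩ := hpol t ht
    have h3 := (hrpos t ht).ne'
    simp only [hw, ← hrsq t ht, hy']
    rw [h1, h2]
    field_simp
    linear_combination -t ^ 2 * Real.sin_sq_add_cos_sq (θ t)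
  · obtain ⟨h1, h2⟩ := hpol t ht
    have h3 := (hrpos t ht).ne'
    simp only [hy']
    rw [h1, h2]
    field_simp
    ring

theorem PruferPair.add_int_mul_two_pi {α κ : ℝ} {r θ : ℝ → ℝ} (H : PruferPair α κ r θ) (k : ℤ) :
    PruferPair α κ r fun t => θ t + k * (2 * Real.pi) where
  pos := H.pos
  angle t ht := by
    simpa only [Real.cos_add_int_mul_two_pi, Real.sin_add_int_mul_two_pi] using
      (H.angle t ht).add_const (k * (2 * Real.pi))
  radius t ht := by
    simpa only [Real.cos_add_int_mul_two_pi, Real.sin_add_int_mul_two_pi] using H.radius t ht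

/-- A continuous function with `tan φ = y / x` differs from a polar angle by a multiple of `π`. -/
theorem phaseFunction_eq {x y r θ φ : ℝ → ℝ} {τ : ℝ}
    (hx : ∀ t ∈ Ici τ, HasDerivAt x (y t) t) (hr : ∀ t ∈ Ici τ, 0 < r t)
    (hθ : ContinuousOn θ (Ici τ))
    (hpol : ∀ t ∈ Ici τ, x t = r t * Real.cos (θ t) ∧ y t = r t * Real.sin (θ t))
    (hφ : IsPhaseFunction x τ φ) :
    ∃ s : ℝ, (s = 0 ∨ s = Real.pi) ∧ ∃ k : ℤ, ∀ t ∈ Ici τ, φ t + s = θ t + k * (2 * Real.pi) := by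
  obtain ⟨hφc, hφt⟩ := hφ
  have hpi := Real.pi_pos
  have hD : ContinuousOn (fun t => φ t - θ t) (Ici τ) := hφc.sub hθ
  have hsin : ∀ t ∈ Ici τ, Real.sin (φ t - θ t) = 0 := by
    have h1 : ∀ t ∈ Ici τ, x t ≠ 0 → Real.sin (φ t - θ t) = 0 := by
      intro t ht hxt
      obtain ⟨a1, a2⟩ := hφt t ht hxt
      obtain ⟨b1, b2⟩ := hpol t ht
      rw [(hx t ht).deriv, Real.tan_eq_sin_div_cos, div_eq_div_iff a1 hxt, b1, b2] at a2
      have h2 := (hr t ht).ne'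
      rw [Real.sin_sub]
      apply mul_left_cancel₀ h2
      linear_combination a2
    intro t ht
    by_cases hxt : x t = 0
    · have hyt : y t ≠ 0 := by
        intro hyt
        obtain ⟨b1, b2⟩ := hpol t ht
        rw [hxt, eq_comm, mul_eq_zero, or_iff_right (hr t ht).ne'] at b1
        rw [hyt, eq_comm, mul_eq_zero, or_iff_right (hr t ht).ne'] at b2
        have := Real.sin_sq_add_cos_sq (θ t)
        rw [b1, b2] at this
        simp at this
      -- the zeros of `x` are isolated
      have h2 : ∀ᶠ u in 𝓝[>] t, x u ≠ 0 := by
        have := (hx t ht).eventually_ne (c := 0) hyt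
        exact this.filter_mono (nhdsWithin_mono _ fun u hu => ne_of_gt hu)
      have h3 : Tendsto (fun u => Real.sin (φ u - θ u)) (𝓝[>] t) (𝓝 (Real.sin (φ t - θ t))) :=
        ((Real.continuous_sin.comp_continuousOn hD) t ht).mono
          (fun u hu => le_trans (show τ ≤ t from ht) (le_of_lt hu))
      refine tendsto_nhds_unique h3 (tendsto_const_nhds.congr' ?_)
      filter_upwards [h2, self_mem_nhdsWithin] with u hu hu'
      exact (h1 u (le_trans (show τ ≤ t from ht) (le_of_lt hu')) hu).symm
    · exact h1 t ht hxt
  have hint : ∀ t ∈ Ici τ, ∃ n : ℤ, n * Real.pi = φ t - θ t := fun t ht =>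
    Real.sin_eq_zero_iff.1 (hsin t ht)
  obtain ⟨m, hm⟩ := hint τ self_mem_Ici
  have hconst : ∀ t ∈ Ici τ, φ t - θ t = m * Real.pi := by
    intro t ht
    obtain ⟨n, hn⟩ := hint t ht
    rw [← hn]
    congr 2
    have hconn := (isPreconnected_Ici.image _ hD).ordConnected
    have mτ : (m : ℝ) * Real.pi ∈ (fun t => φ t - θ t) '' Ici τ := ⟨τ, self_mem_Ici, hm.symm⟩
    have mt : (n : ℝ) * Real.pi ∈ (fun t => φ t - θ t) '' Ici τ := ⟨t, ht, hn.symm⟩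
    have key : ∀ a b : ℤ, (a : ℝ) * Real.pi ∈ (fun t => φ t - θ t) '' Ici τ →
        (b : ℝ) * Real.pi ∈ (fun t => φ t - θ t) '' Ici τ → ¬ a < b := by
      intro a b ha hb hab
      have hab' : (a : ℝ) + 1 ≤ b := by exact_mod_cast hab
      obtain ⟨u, hu, hu'⟩ := hconn.out ha hb (show ((a : ℝ) + 1 / 2) * Real.pi ∈ _ from
        ⟨by nlinarith, by nlinarith⟩)
      obtain ⟨l, hl⟩ := hint u hu
      have h3 : (l : ℝ) = a + 1 / 2 := by
        apply mul_right_cancel₀ hpi.ne'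
        rw [hl]
        exact hu'
      have h4 : (a : ℝ) < l ∧ (l : ℝ) < a + 1 := ⟨by linarith, by linarith⟩
      have h5 : a < l := by exact_mod_cast h4.1
      have h6 : l < a + 1 := by exact_mod_cast h4.2
      omega
    have k1 := key m n mτ mt
    have k2 := key n m mt mτ
    omega
  rcases Int.even_or_odd' m with ⟨k, hk | hk⟩
  · refine ⟨0, Or.inl rfl, k, fun t ht => ?_⟩
    have := hconst t ht
    rw [hk] at this
    push_cast at this
    linarith
  · refine ⟨Real.pi, Or.inr rfl, k + 1, fun t ht => ?_⟩
    have := hconst t ht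
    rw [hk] at this
    push_cast at this ⊢
    linarith

/-! ### Long-time behaviour of the polar coordinates -/

/-- Times after which the perturbation terms in the Prüfer equations are small. -/
structure FarOut (α κ T : ℝ) : Prop where
  four_pi_le : 4 * Real.pi ≤ T
  angle_le : 2 * (2 * α + κ) ≤ T
  radius_lt : 32 * κ < α * T

theorem eventually_farOut {α : ℝ} (hα : 0 < α) (κ : ℝ) : ∀ᶠ T in atTop, FarOut α κ T := by
  filter_upwards [eventually_ge_atTop (4 * Real.pi), eventually_ge_atTop (2 * (2 * α + κ)),
    eventually_gt_atTop (32 * κ / α)] with T h1 h2 h3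
  exact ⟨h1, h2, by rwa [div_lt_iff₀' hα] at h3⟩

theorem FarOut.pos {α κ T : ℝ} (hT : FarOut α κ T) : 0 < T :=
  (by positivity : 0 < 4 * Real.pi).trans_le hT.four_pi_le

theorem FarOut.one_le {α κ T : ℝ} (hT : FarOut α κ T) : 1 ≤ T := by
  linarith [hT.four_pi_le, Real.pi_gt_three]

theorem FarOut.mono {α κ T s : ℝ} (hα : 0 < α) (hT : FarOut α κ T) (h : T ≤ s) :
    FarOut α κ s :=
  ⟨hT.four_pi_le.trans h, hT.angle_le.trans h, hT.radius_lt.trans_le (by gcongr)⟩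

/-- The primitive `∫ sin²`. -/
noncomputable def sinSqPrimitive (θ : ℝ) : ℝ := (θ - Real.sin θ * Real.cos θ) / 2

theorem hasDerivAt_sinSqPrimitive (θ : ℝ) :
    HasDerivAt sinSqPrimitive (Real.sin θ ^ 2) θ := by
  refine (((hasDerivAt_id θ).sub ((Real.hasDerivAt_sin θ).mul
    (Real.hasDerivAt_cos θ))).div_const 2).congr_deriv ?_
  linear_combination (-1 / 2) * Real.sin_sq_add_cos_sq θ

theorem monotone_sinSqPrimitive : Monotone sinSqPrimitive := by
  rw [← monotoneOn_univ]
  exact monotoneOn_of_hasDerivAt convex_univ (fun θ _ => hasDerivAt_sinSqPrimitive θ)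
    fun θ _ => sq_nonneg _

namespace PruferPair

variable {α κ T : ℝ} {r θ : ℝ → ℝ}

theorem angle_deriv_bounds (hα : 0 < α) (hκ : 0 ≤ κ) {t : ℝ} (hT : FarOut α κ t) :
    -2 ≤ -1 - 2 * α / t * (Real.sin (θ t) * Real.cos (θ t)) + κ / t ^ 2 * Real.cos (θ t) ^ 2 ∧
    -1 - 2 * α / t * (Real.sin (θ t) * Real.cos (θ t)) + κ / t ^ 2 * Real.cos (θ t) ^ 2 ≤
      -(1 / 2) := by
  have ht := hT.pos
  have h1 : |Real.sin (θ t) * Real.cos (θ t)| ≤ 1 := by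
    rw [abs_mul]
    exact mul_le_one₀ (Real.abs_sin_le_one _) (abs_nonneg _) (Real.abs_cos_le_one _)
  have h2 : Real.cos (θ t) ^ 2 ≤ 1 := Real.cos_sq_le_one _
  have h3 : |2 * α / t * (Real.sin (θ t) * Real.cos (θ t))| ≤ 2 * α / t := by
    rw [abs_mul, abs_of_pos (by positivity : 0 < 2 * α / t)]
    exact mul_le_of_le_one_right (by positivity) h1
  have h4 : κ / t ^ 2 * Real.cos (θ t) ^ 2 ≤ κ / t := by
    calc κ / t ^ 2 * Real.cos (θ t) ^ 2 ≤ κ / t ^ 2 := mul_le_of_le_one_right (by positivity) h2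
      _ ≤ κ / t := by
        gcongr
        nlinarith [hT.one_le]
  have h5 : 0 ≤ κ / t ^ 2 * Real.cos (θ t) ^ 2 := by positivity
  have h6 : 2 * α / t + κ / t ≤ 1 / 2 := by
    rw [← add_div, div_le_iff₀ ht]; linarith [hT.angle_le]
  have h7 : 0 ≤ κ / t := by positivity
  rw [abs_le] at h3
  constructor <;> linarith [h3.1, h3.2]

theorem angle_sub_bounds (H : PruferPair α κ r θ) (hα : 0 < α) (hκ : 0 ≤ κ)
    (hT : FarOut α κ T) {s t : ℝ} (hs : T ≤ s) (hst : s ≤ t) :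
    (t - s) / 2 ≤ θ s - θ t ∧ θ s - θ t ≤ 2 * (t - s) := by
  have hpos : ∀ u ∈ Ici T, 0 < u := fun u hu => hT.pos.trans_le hu
  have h1 := antitoneOn_of_hasDerivAt (convex_Ici T)
    (fun u hu => (H.angle u (hpos u hu)).add ((hasDerivAt_id u).div_const 2))
    (fun u hu => by linarith [(angle_deriv_bounds (θ := θ) hα hκ (hT.mono hα hu)).2])
    hs (hs.trans hst) hst
  have h2 := monotoneOn_of_hasDerivAt (convex_Ici T)
    (fun u hu => (H.angle u (hpos u hu)).add ((hasDerivAt_id u).const_mul 2))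
    (fun u hu => by linarith [(angle_deriv_bounds (θ := θ) hα hκ (hT.mono hα hu)).1])
    hs (hs.trans hst) hst
  simp only [Pi.add_apply, id] at h1 h2
  constructor <;> linarith

theorem strictAntiOn_angle (H : PruferPair α κ r θ) (hα : 0 < α) (hκ : 0 ≤ κ)
    (hT : FarOut α κ T) : StrictAntiOn θ (Ici T) := fun s hs t _ hst => by
  linarith [(H.angle_sub_bounds hα hκ hT hs hst.le).1]

theorem tendsto_angle (H : PruferPair α κ r θ) (hα : 0 < α) (hκ : 0 ≤ κ)
    (hT : FarOut α κ T) : Tendsto θ atTop atBot := by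
  have h : Tendsto (fun t => -((t - T) / 2) + θ T) atTop atBot :=
    tendsto_atBot_add_const_right _ _ (tendsto_neg_atTop_atBot.comp
      ((tendsto_atTop_add_const_right _ (-T) tendsto_id).atTop_div_const two_pos))
  refine tendsto_atBot_mono' _ ?_ h
  filter_upwards [eventually_ge_atTop T] with t ht
  linarith [(H.angle_sub_bounds hα hκ hT le_rfl ht).1]

theorem continuousOn_angle (H : PruferPair α κ r θ) (hT : 0 < T) : ContinuousOn θ (Ici T) :=
  fun t ht => (H.angle t (hT.trans_le ht)).continuousAt.continuousWithinAt

theorem image_Ici (H : PruferPair α κ r θ) (hα : 0 < α) (hκ : 0 ≤ κ)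
    (hT : FarOut α κ T) : θ '' Ici T = Iic (θ T) := by
  refine Subset.antisymm ?_ fun ψ hψ => ?_
  · rintro _ ⟨t, ht, rfl⟩
    exact (H.strictAntiOn_angle hα hκ hT).antitoneOn self_mem_Ici ht ht
  · obtain ⟨u, hu1, hu2⟩ := (((H.tendsto_angle hα hκ hT).eventually_le_atBot ψ).and
      (eventually_ge_atTop T)).exists
    obtain ⟨v, hv1, hv2⟩ := intermediate_value_Icc' hu2
      ((H.continuousOn_angle hT.pos).mono Icc_subset_Ici_self) ⟨hu1, hψ⟩
    exact ⟨v, hv1.1, hv2⟩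

/-- Since `|θ'| ≤ 2`, the damping `-(2α/u) sin² θ` in `r'/r` at a time `u ≤ t` is at most
`(α/t) sin² θ θ'`, which can be integrated. -/
theorem log_radius_sub_le (H : PruferPair α κ r θ) (hα : 0 < α) (hκ : 0 ≤ κ)
    {s t : ℝ} (hs : FarOut α κ s) (hst : s ≤ t) :
    Real.log (r t) - Real.log (r s) ≤
      α / t * (sinSqPrimitive (θ t) - sinSqPrimitive (θ s)) + κ / s ^ 2 * (t - s) := by
  have hs0 := hs.pos
  have ht0 : 0 < t := hs0.trans_le hst
  have hpos : ∀ u ∈ Icc s t, 0 < u := fun u hu => hs0.trans_le hu.1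
  have h := antitoneOn_of_hasDerivAt (convex_Icc s t)
    (fun u hu => (((H.radius u (hpos u hu)).log (H.pos u (hpos u hu)).ne').sub
      (((hasDerivAt_sinSqPrimitive (θ u)).comp u (H.angle u (hpos u hu))).const_mul (α / t))).sub
      ((hasDerivAt_id u).const_mul (κ / s ^ 2)))
    (fun u hu => by
      have hu0 := hpos u hu
      have h1 := (angle_deriv_bounds (θ := θ) hα hκ (hs.mono hα hu.1)).1
      set w := -1 - 2 * α / u * (Real.sin (θ u) * Real.cos (θ u)) +
        κ / u ^ 2 * Real.cos (θ u) ^ 2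
      have h2 : α / t ≤ α / u := by gcongr; exact hu.2
      have h3 : κ / u ^ 2 ≤ κ / s ^ 2 := by gcongr; exact hu.1
      have h4 : Real.sin (θ u) * Real.cos (θ u) ≤ 1 := by
        nlinarith [sq_nonneg (Real.sin (θ u) - Real.cos (θ u)), Real.sin_sq_add_cos_sq (θ u)]
      have h5 : κ / u ^ 2 * (Real.sin (θ u) * Real.cos (θ u)) ≤ κ / s ^ 2 :=
        (mul_le_of_le_one_right (by positivity) h4).trans h3
      have h6 : -(α / t * (Real.sin (θ u) ^ 2 * w)) ≤ 2 * (α / u) * Real.sin (θ u) ^ 2 := by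
        have h7 : α / t * Real.sin (θ u) ^ 2 * (-w) ≤ α / u * Real.sin (θ u) ^ 2 * 2 :=
          mul_le_mul (by gcongr) (by linarith) (by
            linarith [(angle_deriv_bounds (θ := θ) hα hκ (hs.mono hα hu.1)).2]) (by positivity)
        linarith
      rw [mul_div_cancel_left₀ _ (H.pos u hu0).ne']
      have h8 : Real.sin (θ u) * (-(2 * α / u) * Real.sin (θ u) + κ / u ^ 2 * Real.cos (θ u)) =
        -(2 * (α / u) * Real.sin (θ u) ^ 2) +
          κ / u ^ 2 * (Real.sin (θ u) * Real.cos (θ u)) := by ring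
      rw [h8]
      linarith)
    (left_mem_Icc.2 hst) (right_mem_Icc.2 hst) hst
  simp only [Pi.sub_apply, Function.comp_apply, id] at h
  linarith

/-- Over a time interval in which `∫ sin²` grows by `π / 4` the damping beats the term of
order `κ / t²`. -/
theorem radius_lt (H : PruferPair α κ r θ) (hα : 0 < α) (hκ : 0 ≤ κ)
    {s t : ℝ} (hs : FarOut α κ s) (hst : s ≤ t) (hlen : t - s ≤ 4 * Real.pi)
    (hsin : Real.pi / 4 ≤ sinSqPrimitive (θ s) - sinSqPrimitive (θ t)) : r t < r s := by
  have hs0 := hs.pos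
  have ht0 : 0 < t := hs0.trans_le hst
  have hpi := Real.pi_pos
  have h := H.log_radius_sub_le hα hκ hs hst
  have h2s : t ≤ 2 * s := by linarith [hs.four_pi_le]
  have h1 : α / t * (sinSqPrimitive (θ t) - sinSqPrimitive (θ s)) ≤
      -(α / (2 * s) * (Real.pi / 4)) := by
    have : α / (2 * s) * (Real.pi / 4) ≤
        α / t * (sinSqPrimitive (θ s) - sinSqPrimitive (θ t)) := by gcongr
    linarith
  have h2 : κ / s ^ 2 * (t - s) ≤ κ / s ^ 2 * (4 * Real.pi) := by gcongr
  have h3 : κ / s ^ 2 * (4 * Real.pi) < α / (2 * s) * (Real.pi / 4) := by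
    rw [div_mul_eq_mul_div, div_mul_eq_mul_div, div_lt_div_iff₀ (by positivity) (by positivity)]
    nlinarith [mul_pos (mul_pos hs0 hpi) (sub_pos.2 hs.radius_lt)]
  exact (Real.log_lt_log_iff (H.pos t ht0) (H.pos s hs0)).1 (by linarith)

theorem sinSqPrimitive_sub_two_pi (ψ : ℝ) :
    sinSqPrimitive (ψ - 2 * Real.pi) = sinSqPrimitive ψ - Real.pi := by
  rw [sinSqPrimitive, sinSqPrimitive, Real.sin_sub_two_pi, Real.cos_sub_two_pi]; ring

theorem radius_turn (H : PruferPair α κ r θ) (hα : 0 < α) (hκ : 0 ≤ κ)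
    (hT : FarOut α κ T) {s t : ℝ} (hs : T ≤ s) (hst : s ≤ t) (hturn : θ t = θ s - 2 * Real.pi) :
    t - s ≤ 4 * Real.pi ∧ r t < r s := by
  have h := (H.angle_sub_bounds hα hκ hT hs hst).1
  have hlen : t - s ≤ 4 * Real.pi := by linarith
  refine ⟨hlen, H.radius_lt hα hκ (hT.mono hα hs) hst hlen ?_⟩
  rw [hturn, sinSqPrimitive_sub_two_pi]
  linarith [Real.pi_pos]

theorem radius_sub_le (H : PruferPair α κ r θ) (hα : 0 < α) (hκ : 0 ≤ κ) {B : ℝ} (hB : 0 ≤ B)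
    {s t : ℝ} (hs : 1 ≤ s) (hst : s ≤ t) (hr : ∀ u ∈ Icc s t, r u ≤ B * u ^ (-α)) :
    r s - r t ≤ B * (2 * α + κ) * s ^ (-α - 1) * (t - s) := by
  have hs0 : 0 < s := one_pos.trans_le hs
  have hpos : ∀ u ∈ Icc s t, 0 < u := fun u hu => hs0.trans_le hu.1
  have h := monotoneOn_of_hasDerivAt (convex_Icc s t)
    (fun u hu => (H.radius u (hpos u hu)).add
      ((hasDerivAt_id u).const_mul (B * (2 * α + κ) * s ^ (-α - 1))))
    (fun u hu => by
      have hu0 := hpos u hu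
      have hu1 : 1 ≤ u := hs.trans hu.1
      have h1 : r u ≤ B * s ^ (-α) := (hr u hu).trans (by
        gcongr ?_ * ?_
        exact Real.rpow_le_rpow_of_nonpos hs0 hu.1 (by linarith))
      have h2 : -(Real.sin (θ u) * (-(2 * α / u) * Real.sin (θ u) +
          κ / u ^ 2 * Real.cos (θ u))) ≤ (2 * α + κ) / s := by
        have a1 : Real.sin (θ u) ^ 2 ≤ 1 := Real.sin_sq_le_one _
        have a2 : -(Real.sin (θ u) * Real.cos (θ u)) ≤ 1 := by
          nlinarith [sq_nonneg (Real.sin (θ u) + Real.cos (θ u)), Real.sin_sq_add_cos_sq (θ u)]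
        have a3 : 2 * α / u * Real.sin (θ u) ^ 2 ≤ 2 * α / s :=
          (mul_le_of_le_one_right (by positivity) a1).trans (by gcongr; exact hu.1)
        have a4 : κ / u ^ 2 * -(Real.sin (θ u) * Real.cos (θ u)) ≤ κ / s :=
          (mul_le_of_le_one_right (by positivity) a2).trans (by
            gcongr
            nlinarith [hu.1])
        rw [add_div]
        linarith
      have h3 : -(r u * (Real.sin (θ u) * (-(2 * α / u) * Real.sin (θ u) +
          κ / u ^ 2 * Real.cos (θ u)))) ≤ B * (2 * α + κ) * s ^ (-α - 1) := by
        have hr0 := (H.pos u hu0).le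
        rw [← mul_neg, Real.rpow_sub_one hs0.ne']
        calc _ ≤ r u * ((2 * α + κ) / s) := by gcongr
          _ ≤ B * s ^ (-α) * ((2 * α + κ) / s) := by gcongr
          _ = _ := by ring
      linarith)
    (left_mem_Icc.2 hst) (right_mem_Icc.2 hst) hst
  simp only [Pi.add_apply, id] at h
  linarith

/-- Along a solution the polar angle is comparable to the time. -/
theorem exists_abs_angle_bounds (H : PruferPair α κ r θ) (hα : 0 < α) (hκ : 0 ≤ κ)
    (hT : FarOut α κ T) (hneg : θ T < 0) :
    ∃ K : ℝ, 0 < K ∧ ∀ t ∈ Ici T, t ≤ K * |θ t| ∧ |θ t| ≤ K * t := by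
  have hT0 := hT.pos
  refine ⟨2 + T / -θ T + -θ T / T, ?_, fun t ht => ?_⟩
  · have : 0 < T / -θ T := div_pos hT0 (by linarith)
    have : 0 < -θ T / T := div_pos (by linarith) hT0
    positivity
  · have ht : T ≤ t := ht
    obtain ⟨h1, h2⟩ := H.angle_sub_bounds hα hκ hT le_rfl ht
    have e1 : T / -θ T * -θ T = T := div_mul_cancel₀ _ (by linarith)
    have e2 : -θ T / T * T = -θ T := div_mul_cancel₀ _ hT0.ne'
    have p1 : 0 < T / -θ T := div_pos hT0 (by linarith)
    have p2 : 0 < -θ T / T := div_pos (by linarith) hT0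
    have h3 : -θ T ≤ -θ t := by linarith
    have m1 : T ≤ T / -θ T * -θ t := by
      calc T = T / -θ T * -θ T := e1.symm
        _ ≤ _ := by gcongr
    have m2 : -θ T ≤ -θ T / T * t := by
      calc -θ T = -θ T / T * T := e2.symm
        _ ≤ _ := by gcongr
    have m3 : 0 ≤ -θ T / T * -θ t := mul_nonneg p2.le (by linarith)
    have m4 : 0 ≤ T / -θ T * t := mul_nonneg p1.le (by linarith)
    rw [abs_of_neg (by linarith)]
    constructor <;> nlinarith

end PruferPair

/-! ### The spiral traced by the phase point -/

/-- The radius as a function of the polar angle, for times `t ≥ T`. -/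
noncomputable def polarRadius (r θ : ℝ → ℝ) (T ψ : ℝ) : ℝ := r (Function.invFunOn θ (Ici T) ψ)

namespace PruferPair

variable {α κ T : ℝ} {r θ : ℝ → ℝ}

theorem polarRadius_angle (H : PruferPair α κ r θ) (hα : 0 < α) (hκ : 0 ≤ κ)
    (hT : FarOut α κ T) {t : ℝ} (ht : t ∈ Ici T) : polarRadius r θ T (θ t) = r t := by
  rw [polarRadius, (H.strictAntiOn_angle hα hκ hT).injOn.leftInvOn_invFunOn ht]

theorem exists_time (H : PruferPair α κ r θ) (hα : 0 < α) (hκ : 0 ≤ κ)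
    (hT : FarOut α κ T) {ψ : ℝ} (hψ : ψ ≤ θ T) : ∃ t ∈ Ici T, θ t = ψ := by
  have : ψ ∈ θ '' Ici T := by rwa [H.image_Ici hα hκ hT]
  exact this

theorem polarRadius_bounds (H : PruferPair α κ r θ) (hα : 0 < α) (hκ : 0 ≤ κ)
    (hT : FarOut α κ T) (hneg : θ T < 0) {A B : ℝ} (hA : 0 < A) (hB : 0 < B)
    (hr : ∀ t ∈ Ici T, A * t ^ (-α) ≤ r t ∧ r t ≤ B * t ^ (-α)) :
    ∃ C D : ℝ, 0 < C ∧ 0 < D ∧ ∀ ψ ≤ θ T, C * |ψ| ^ (-α) ≤ polarRadius r θ T ψ ∧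
      polarRadius r θ T ψ ≤ D * |ψ| ^ (-α) := by
  obtain ⟨K, hK, hKt⟩ := H.exists_abs_angle_bounds hα hκ hT hneg
  refine ⟨A * K ^ (-α), B * (K⁻¹) ^ (-α), by positivity, by positivity, fun ψ hψ => ?_⟩
  obtain ⟨t, ht, rfl⟩ := H.exists_time hα hκ hT hψ
  rw [H.polarRadius_angle hα hκ hT ht]
  obtain ⟨h1, h2⟩ := hr t ht
  obtain ⟨k1, k2⟩ := hKt t ht
  have ht0 : 0 < t := hT.pos.trans_le ht
  have hθ0 : 0 < |θ t| := abs_pos.2 (by linarith)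
  constructor
  · refine le_trans ?_ h1
    rw [mul_assoc, ← Real.mul_rpow hK.le hθ0.le]
    exact mul_le_mul_of_nonneg_left (Real.rpow_le_rpow_of_nonpos ht0 k1 (by linarith)) hA.le
  · refine h2.trans ?_
    rw [mul_assoc, ← Real.mul_rpow (inv_pos.2 hK).le hθ0.le]
    refine mul_le_mul_of_nonneg_left (Real.rpow_le_rpow_of_nonpos (by positivity) ?_
      (by linarith)) hB.le
    rwa [inv_mul_le_iff₀ hK]

/-- Consecutive turns: the radius decreases strictly, by `O(|ψ|^(-α-1))`. -/
theorem polarRadius_gap (H : PruferPair α κ r θ) (hα : 0 < α) (hκ : 0 ≤ κ)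
    (hT : FarOut α κ T) (hneg : θ T < 0) {B : ℝ} (hB : 0 < B)
    (hr : ∀ t ∈ Ici T, r t ≤ B * t ^ (-α)) :
    ∃ C : ℝ, 0 < C ∧ ∀ ψ ≤ θ T, polarRadius r θ T (ψ - 2 * Real.pi) < polarRadius r θ T ψ ∧
      polarRadius r θ T ψ - polarRadius r θ T (ψ - 2 * Real.pi) ≤ C * |ψ| ^ (-α - 1) := by
  have hpi := Real.pi_pos
  obtain ⟨K, hK, hKt⟩ := H.exists_abs_angle_bounds hα hκ hT hneg
  refine ⟨B * (2 * α + κ) * (K⁻¹) ^ (-α - 1) * (4 * Real.pi), by positivity, fun ψ hψ => ?_⟩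
  obtain ⟨s, hs, hsψ⟩ := H.exists_time hα hκ hT hψ
  obtain ⟨t, ht, htψ⟩ := H.exists_time hα hκ hT (show ψ - 2 * Real.pi ≤ θ T by linarith)
  have hst : s ≤ t := by
    refine ((H.strictAntiOn_angle hα hκ hT).le_iff_ge ht hs).1 ?_
    rw [hsψ, htψ]; linarith
  rw [← htψ, ← hsψ, H.polarRadius_angle hα hκ hT hs, H.polarRadius_angle hα hκ hT ht]
  obtain ⟨h1, h2⟩ := H.radius_turn hα hκ hT hs hst (by rw [hsψ, htψ])
  refine ⟨h2, ?_⟩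
  have hs : T ≤ s := hs
  have hs0 : 0 < s := hT.pos.trans_le hs
  have hθ0 : 0 < |θ s| := abs_pos.2 (by linarith)
  have h3 := H.radius_sub_le hα hκ hB.le (hT.one_le.trans hs) hst
    fun u hu => hr u (hs.trans hu.1)
  have h4 : s ^ (-α - 1) ≤ (K⁻¹ * |θ s|) ^ (-α - 1) := by
    refine Real.rpow_le_rpow_of_nonpos (by positivity) ?_ (by linarith)
    rw [inv_mul_le_iff₀ hK]
    exact (hKt s hs).2
  rw [Real.mul_rpow (by positivity) hθ0.le] at h4
  calc r s - r t ≤ B * (2 * α + κ) * s ^ (-α - 1) * (t - s) := h3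
    _ ≤ B * (2 * α + κ) * (K⁻¹ ^ (-α - 1) * |θ s| ^ (-α - 1)) * (4 * Real.pi) := by
      have : 0 ≤ t - s := by linarith
      gcongr
    _ = _ := by ring

theorem tendsto_polarRadius (H : PruferPair α κ r θ) (hα : 0 < α) (hκ : 0 ≤ κ)
    (hT : FarOut α κ T) (hneg : θ T < 0) {A B : ℝ} (hA : 0 < A) (hB : 0 < B)
    (hr : ∀ t ∈ Ici T, A * t ^ (-α) ≤ r t ∧ r t ≤ B * t ^ (-α)) :
    Tendsto (polarRadius r θ T) atBot (𝓝 0) := by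
  obtain ⟨C, D, hC, hD, h⟩ := H.polarRadius_bounds hα hκ hT hneg hA hB hr
  have hlim : Tendsto (fun ψ : ℝ => D * |ψ| ^ (-α)) atBot (𝓝 0) := by
    simpa using ((tendsto_rpow_neg_atTop hα).comp tendsto_abs_atBot_atTop).const_mul D
  refine tendsto_of_tendsto_of_tendsto_of_le_of_le' tendsto_const_nhds hlim ?_ ?_
  · filter_upwards [eventually_le_atBot (θ T)] with ψ hψ
    exact le_trans (by positivity) (h ψ hψ).1
  · filter_upwards [eventually_le_atBot (θ T)] with ψ hψ
    exact (h ψ hψ).2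

theorem isNegSpiral (H : PruferPair α κ r θ) (hα : 0 < α) (hκ : 0 ≤ κ)
    (hT : FarOut α κ T) (hneg : θ T < 0) {A B : ℝ} (hA : 0 < A) (hB : 0 < B)
    (hr : ∀ t ∈ Ici T, A * t ^ (-α) ≤ r t ∧ r t ≤ B * t ^ (-α)) :
    IsNegSpiral (polarRadius r θ T) (θ T) := by
  have hmem : ∀ φ ∈ Ici |θ T|, -φ ≤ θ T := fun φ hφ => by
    have : |θ T| ≤ φ := hφ
    rw [abs_of_neg hneg] at this
    linarith
  obtain ⟨C, -, hgap⟩ := H.polarRadius_gap hα hκ hT hneg hB fun t ht => (hr t ht).2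
  refine ⟨hneg, ⟨abs_pos.2 hneg.ne, fun φ hφ => ?_, ?_, fun φ hφ => ?_⟩⟩
  · obtain ⟨t, ht, htψ⟩ := H.exists_time hα hκ hT (hmem φ hφ)
    rw [← htψ, H.polarRadius_angle hα hκ hT ht]
    exact H.pos t (hT.pos.trans_le ht)
  · exact (H.tendsto_polarRadius hα hκ hT hneg hA hB hr).comp tendsto_neg_atTop_atBot
  · refine strictAnti_nat_of_succ_lt fun k => ?_
    have hk : -(φ + 2 * (k : ℝ) * Real.pi) ≤ θ T := by
      have : 0 ≤ 2 * (k : ℝ) * Real.pi := by positivity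
      linarith [hmem φ hφ]
    have e : -(φ + 2 * ((k + 1 : ℕ) : ℝ) * Real.pi) =
        -(φ + 2 * (k : ℝ) * Real.pi) - 2 * Real.pi := by push_cast; ring
    rw [e]
    exact (hgap _ hk).1

theorem polarGraph_polarRadius (H : PruferPair α κ r θ) (hα : 0 < α) (hκ : 0 ≤ κ)
    (hT : FarOut α κ T) : polarGraph (polarRadius r θ T) (Iic (θ T)) =
      (fun t => !₂[r t * Real.cos (θ t), r t * Real.sin (θ t)]) '' Ici T := by
  rw [polarGraph, ← H.image_Ici hα hκ hT, image_image]
  refine image_congr fun t ht => ?_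
  rw [H.polarRadius_angle hα hκ hT ht]

end PruferPair

/-! ### The box dimension of the phase curve -/

theorem abs_sub_le_of_abs_deriv_le {f f' : ℝ → ℝ} {τ α D : ℝ} (hτ : 0 < τ) (hα : α < 1)
    (hf : ∀ t ∈ Ici τ, HasDerivAt f (f' t) t) (hb : ∀ t ∈ Ici τ, |f' t| ≤ D * t ^ (-α))
    {s t : ℝ} (hs : s ∈ Ici τ) (ht : t ∈ Ici τ) :
    |f s - f t| ≤ |D / (1 - α) * s ^ (1 - α) - D / (1 - α) * t ^ (1 - α)| := by
  have hS : ∀ t ∈ Ici τ, HasDerivAt (fun t : ℝ => D / (1 - α) * t ^ (1 - α)) (D * t ^ (-α)) t :=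
    fun t ht => by
      have ht0 : t ≠ 0 := (hτ.trans_le ht).ne'
      have h1 : 1 - α ≠ 0 := by linarith
      refine ((Real.hasDerivAt_rpow_const (p := 1 - α) (Or.inl ht0)).const_mul _).congr_deriv ?_
      rw [show 1 - α - 1 = -α by ring]
      field_simp
  have h1 := antitoneOn_of_hasDerivAt (convex_Ici τ) (fun t ht => (hf t ht).sub (hS t ht))
    fun t ht => by linarith [le_of_abs_le (hb t ht)]
  have h2 := monotoneOn_of_hasDerivAt (convex_Ici τ) (fun t ht => (hf t ht).add (hS t ht))
    fun t ht => by linarith [neg_le_of_abs_le (hb t ht)]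
  rcases le_total s t with h | h
  · have a1 := h1 hs ht h
    have a2 := h2 hs ht h
    simp only [Pi.sub_apply, Pi.add_apply] at a1 a2
    exact (abs_le.2 ⟨by linarith, by linarith⟩ : |f s - f t| ≤
      -(D / (1 - α) * s ^ (1 - α) - D / (1 - α) * t ^ (1 - α))).trans (neg_le_abs _)
  · have a1 := h1 ht hs h
    have a2 := h2 ht hs h
    simp only [Pi.sub_apply, Pi.add_apply] at a1 a2
    exact (abs_le.2 ⟨by linarith, by linarith⟩ : |f s - f t| ≤
      D / (1 - α) * s ^ (1 - α) - D / (1 - α) * t ^ (1 - α)).trans (le_abs_self _)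

theorem contDiffOn_one_of_hasDerivAt {f f' : ℝ → ℝ} {U : Set ℝ} (hU : IsOpen U)
    (hf : ∀ t ∈ U, HasDerivAt f (f' t) t) (hf' : ContinuousOn f' U) : ContDiffOn ℝ 1 f U := by
  rw [← zero_add (1 : WithTop ℕ∞), contDiffOn_succ_iff_deriv_of_isOpen hU]
  refine ⟨fun t ht => (hf t ht).differentiableAt.differentiableWithinAt, by simp, ?_⟩
  rw [contDiffOn_zero]
  exact hf'.congr fun t ht => (hf t ht).deriv

namespace SolvesPhase

variable {α κ τ : ℝ} {x y : ℝ → ℝ}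

theorem contDiffOn (H : SolvesPhase α κ x y) : ContDiffOn ℝ 1 x (Ioi 0) :=
  contDiffOn_one_of_hasDerivAt isOpen_Ioi (fun t ht => (H t ht).1)
    fun t ht => (H t ht).2.continuousAt.continuousWithinAt

theorem phaseCurve_eq (H : SolvesPhase α κ x y) (hτ : 0 < τ) :
    phaseCurve x τ = (fun t => !₂[x t, y t]) '' Ici τ :=
  image_congr fun t ht => by rw [(H t (hτ.trans_le ht)).1.deriv]

theorem phaseRadius_eq (H : SolvesPhase α κ x y) {t : ℝ} (ht : 0 < t) :
    phaseRadius x t = Real.sqrt (x t ^ 2 + y t ^ 2) := by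
  rw [phaseRadius, (H t ht).1.deriv]

theorem volume_thickening_phaseCurve_le (H : SolvesPhase α κ x y) (hα : 0 < α) (hα' : α < 1)
    (hκ : 0 ≤ κ) (hτ : 0 < τ) {B : ℝ} (hB : 0 < B)
    (hr : ∀ t ∈ Ici τ, Real.sqrt (x t ^ 2 + y t ^ 2) ≤ B * t ^ (-α)) :
    ∃ K : ℝ, ∀ᶠ ε : ℝ in 𝓝[>] 0, volume (Metric.thickening ε (phaseCurve x τ)) ≤
      ENNReal.ofReal (K * ε ^ (2 * α / (1 + α))) := by
  set M : ℝ := 2 * α / τ + 1 + κ / τ ^ 2 with hM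
  have hM1 : 1 ≤ M := by
    have : 0 ≤ 2 * α / τ := by positivity
    have : 0 ≤ κ / τ ^ 2 := by positivity
    linarith
  have hpos : ∀ t ∈ Ici τ, 0 < t := fun t ht => hτ.trans_le ht
  have hxr : ∀ t, |x t| ≤ Real.sqrt (x t ^ 2 + y t ^ 2) := fun t =>
    Real.abs_le_sqrt (by linarith [sq_nonneg (y t)])
  have hyr : ∀ t, |y t| ≤ Real.sqrt (x t ^ 2 + y t ^ 2) := fun t =>
    Real.abs_le_sqrt (by linarith [sq_nonneg (x t)])
  have hx' : ∀ t ∈ Ici τ, |y t| ≤ M * B * t ^ (-α) := fun t ht => by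
    have h1 := (hyr t).trans (hr t ht)
    rw [mul_assoc]
    exact h1.trans (le_mul_of_one_le_left ((abs_nonneg _).trans h1) hM1)
  have hy' : ∀ t ∈ Ici τ, |-(2 * α / t) * y t - (1 - κ / t ^ 2) * x t| ≤ M * B * t ^ (-α) := by
    intro t ht
    have ht0 := hpos t ht
    have h1 := (hyr t).trans (hr t ht)
    have h2 := (hxr t).trans (hr t ht)
    have ht : τ ≤ t := ht
    have e1 : |-(2 * α / t) * y t| ≤ 2 * α / τ * (B * t ^ (-α)) := by
      rw [abs_mul, abs_neg, abs_of_pos (by positivity : 0 < 2 * α / t)]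
      gcongr
    have e2 : |(1 - κ / t ^ 2) * x t| ≤ (1 + κ / τ ^ 2) * (B * t ^ (-α)) := by
      rw [abs_mul]
      have h3 : κ / t ^ 2 ≤ κ / τ ^ 2 := by gcongr
      have h4 : 0 ≤ κ / t ^ 2 := by positivity
      gcongr
      exact abs_le.2 ⟨by linarith, by linarith⟩
    calc _ ≤ |-(2 * α / t) * y t| + |(1 - κ / t ^ 2) * x t| := abs_sub _ _
      _ ≤ 2 * α / τ * (B * t ^ (-α)) + (1 + κ / τ ^ 2) * (B * t ^ (-α)) := add_le_add e1 e2
      _ = _ := by rw [hM]; ring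
  have hα1 : 0 < 1 - α := by linarith
  rw [H.phaseCurve_eq hτ]
  refine volume_thickening_curve_le (C := B) (D := 2 * (M * B / (1 - α))) hτ hα hα' hB
    (by positivity) (fun t ht => by rw [norm_toLp_pair]; exact hr t ht) fun s hs t ht => ?_
  refine (dist_toLp_le _ _ _ _).trans ?_
  have a1 := abs_sub_le_of_abs_deriv_le hτ hα' (fun t ht => (H t (hpos t ht)).1) hx' hs ht
  have a2 := abs_sub_le_of_abs_deriv_le hτ hα' (fun t ht => (H t (hpos t ht)).2) hy' hs ht
  rw [mul_assoc, mul_assoc, ← mul_sub, abs_mul, abs_two]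
  linarith

theorem hasBoxDim_phaseCurve (H : SolvesPhase α κ x y) (hα : 0 < α) (hα' : α < 1) (hκ : 0 ≤ κ)
    (hτ : 0 < τ) {t₀ : ℝ} (ht₀ : 0 < t₀) (hx : x t₀ ≠ 0) :
    HasBoxDim (phaseCurve x τ) (2 / (1 + α)) := by
  obtain ⟨A, B, hA, hB, hr⟩ := H.exists_radius_bounds ht₀ hx hτ
  obtain ⟨θ, P, hpol⟩ := H.exists_pruferPair fun t ht => H.sq_add_sq_pos ht₀ hx ht
  obtain ⟨T₀, hT₀⟩ := (eventually_farOut hα κ).exists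
  obtain ⟨T, hT, hTτ, hneg⟩ := ((eventually_farOut hα κ).and ((eventually_ge_atTop τ).and
    ((P.tendsto_angle hα hκ hT₀).eventually_lt_atBot 0))).exists
  have hrT : ∀ t ∈ Ici T, A * t ^ (-α) ≤ Real.sqrt (x t ^ 2 + y t ^ 2) ∧
      Real.sqrt (x t ^ 2 + y t ^ 2) ≤ B * t ^ (-α) := fun t ht => hr t (hTτ.trans ht)
  obtain ⟨K, hK⟩ := H.volume_thickening_phaseCurve_le hα hα' hκ hτ hB fun t ht => (hr t ht).2
  obtain ⟨C, D, hC, hD, hCD⟩ := P.polarRadius_bounds hα hκ hT hneg hA hB hrT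
  obtain ⟨C', hC', hgap⟩ := P.polarRadius_gap hα hκ hT hneg hB fun t ht => (hrT t ht).2
  have hneg' : 0 < -θ T := by linarith
  obtain ⟨k, hk, hk'⟩ := volume_thickening_polarGraph_ge hα hC hC' hneg'
    (P.tendsto_polarRadius hα hκ hT hneg hA hB hrT)
    (fun ψ hψ => (hgap ψ (by linarith)).2) (fun ψ hψ => (hCD ψ (by linarith)).1)
  have hsub : polarGraph (polarRadius (fun t => Real.sqrt (x t ^ 2 + y t ^ 2)) θ T)
      (Iic (- -θ T)) ⊆ phaseCurve x τ := by
    rw [neg_neg, P.polarGraph_polarRadius hα hκ hT, H.phaseCurve_eq hτ]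
    rintro _ ⟨t, ht, rfl⟩
    refine ⟨t, hTτ.trans ht, ?_⟩
    obtain ⟨h1, h2⟩ := hpol t (hT.pos.trans_le ht)
    simp only [← h1, ← h2]
  have hexp : ((2 : ℕ) : ℝ) - 2 / (1 + α) = 2 * α / (1 + α) := by
    push_cast; field_simp; ring
  refine hasBoxDim_of_volume_bounds ?_ (by positivity) hk (K := K) ?_ ?_
  · rw [H.phaseCurve_eq hτ]
    refine isBounded_iff_forall_norm_le.2 ⟨B * τ ^ (-α), ?_⟩
    rintro _ ⟨t, ht, rfl⟩
    rw [norm_toLp_pair]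
    exact (hr t ht).2.trans (mul_le_mul_of_nonneg_left
      (Real.rpow_le_rpow_of_nonpos hτ ht (by linarith)) hB.le)
  · rw [hexp]
    filter_upwards [hk'] with ε hε
    exact hε.trans (measure_mono (Metric.thickening_subset_of_subset ε hsub))
  · rwa [hexp]

end SolvesPhase

/-! ### Waviness -/

theorem isLittleO_rpow_atTop_of_lt {p q : ℝ} (h : p < q) :
    (fun t : ℝ => t ^ p) =o[atTop] fun t => t ^ q := by
  refine (Asymptotics.isLittleO_iff_tendsto' ?_).2 ?_
  · filter_upwards [eventually_gt_atTop 0] with t ht h0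
    exact absurd h0 (Real.rpow_pos_of_pos ht q).ne'
  · refine (tendsto_rpow_neg_atTop (sub_pos.2 h)).congr' ?_
    filter_upwards [eventually_gt_atTop 0] with t ht
    rw [← Real.rpow_sub ht, neg_sub]

/-- Waviness from the turning points: `R` decreases on `[c k, a k]`, increases on `[a k, b k]` and
decreases again on `[b k, c (k + 1)]`, where it returns to the value `R (a k)`. -/
theorem isWavyFunction_of_turning_points {R ρ : ℝ → ℝ} {a b c : ℕ → ℝ} {ε β : ℝ}
    (hR1 : ContDiffOn ℝ 1 R (Ici (c 0))) (hRpos : ∀ s ∈ Ici (c 0), 0 < R s)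
    (hR : ∀ s ∈ Ici (c 0), HasDerivWithinAt R (ρ s) (Ici (c 0)) s) (hρ0 : ρ (c 0) ≤ 0)
    (hε : 0 < ε) (hca : ∀ k, ε ≤ a k - c k) (hab : ∀ k, a k < b k) (hbc : ∀ k, b k < c (k + 1))
    (hca' : ∀ k, ∀ s ∈ Ioo (c k) (a k), ρ s ≤ 0) (hab' : ∀ k, ∀ s ∈ Ioo (a k) (b k), 0 < ρ s)
    (hbc' : ∀ k, ∀ s ∈ Ioo (b k) (c (k + 1)), ρ s < 0) (hret : ∀ k, R (c (k + 1)) = R (a k))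
    (ha : Tendsto a atTop atTop) (hβ : β ∈ Ioo (0 : ℝ) 1)
    (hosc : (fun k => R (b k) - R (a k)) =o[atTop] fun k => (a k) ^ (-β - 1)) :
    IsWavyFunction R (c 0) := by
  have hca0 : ∀ k, c k < a k := fun k => by linarith [hca k]
  have hcc : Monotone c := monotone_nat_of_le_succ fun k =>
    ((hca0 k).trans ((hab k).trans (hbc k))).le
  have hc0 : ∀ k, c 0 ≤ c k := fun k => hcc (Nat.zero_le k)
  have hd : ∀ s ∈ Ici (c 0), derivWithin R (Ici (c 0)) s = ρ s := fun s hs =>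
    (hR s hs).derivWithin (uniqueDiffOn_Ici _ s hs)
  have hd' : ∀ s ∈ Ioi (c 0), deriv R s = ρ s := fun s hs =>
    ((hR s (mem_Ici.2 (le_of_lt hs))).hasDerivAt (Ici_mem_nhds hs)).deriv
  have hcont : ContinuousOn R (Ici (c 0)) := hR1.continuousOn
  have hup : ∀ k, StrictMonoOn R (Icc (a k) (b k)) := fun k => by
    have hk := (hc0 k).trans_lt (hca0 k)
    refine strictMonoOn_of_deriv_pos (convex_Icc _ _)
      (hcont.mono fun s hs => hk.le.trans hs.1) fun s hs => ?_
    rw [interior_Icc] at hs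
    rw [hd' s (hk.trans hs.1)]
    exact hab' k s hs
  have hdown : ∀ k, StrictAntiOn R (Icc (b k) (c (k + 1))) := fun k => by
    have hk := ((hc0 k).trans_lt (hca0 k)).trans (hab k)
    refine strictAntiOn_of_deriv_neg (convex_Icc _ _)
      (hcont.mono fun s hs => hk.le.trans hs.1) fun s hs => ?_
    rw [interior_Icc] at hs
    rw [hd' s (hk.trans hs.1)]
    exact hbc' k s hs
  -- the sequence `c 0, a 0, c 1, a 1, …`
  set u : ℕ → ℝ := fun m => if Even m then c (m / 2) else a (m / 2) with hu
  have hu0 : ∀ k, u (2 * k) = c k := fun k => by simp [hu]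
  have hu1 : ∀ k, u (2 * k + 1) = a k := fun k => by
    have h1 : ¬ Even (2 * k + 1) := by simp
    have h2 : (2 * k + 1) / 2 = k := by omega
    simp only [hu, if_neg h1, h2]
  have hu2 : ∀ k, u (2 * k + 2) = c (k + 1) := fun k => hu0 (k + 1)
  have hmono : StrictMono u := by
    refine strictMono_nat_of_lt_succ fun m => ?_
    rcases Nat.even_or_odd' m with ⟨k, rfl | rfl⟩
    · rw [hu0, hu1]; exact hca0 k
    · rw [hu1, show 2 * k + 1 + 1 = 2 * k + 2 from rfl, hu2]
      exact (hab k).trans (hbc k)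
  have hutop : Tendsto u atTop atTop := by
    refine tendsto_atTop_atTop_of_monotone hmono.monotone fun M => ?_
    obtain ⟨k, hk⟩ := (ha.eventually_ge_atTop M).exists
    exact ⟨2 * k + 1, by rwa [hu1]⟩
  refine ⟨hR1, hRpos, by rw [hd _ self_mem_Ici]; exact hρ0, u, hu0 0, fun k => ?_, fun k => ?_,
    ⟨hmono, hutop⟩, ⟨ε, hε, fun k => by rw [hu0, hu1]; exact hca k⟩, β, hβ, ?_⟩
  · rw [hu0, hu1]
    constructor
    · rintro s ⟨h1, h2⟩
      by_contra! h3
      rw [hd s ((hc0 k).trans h1.le)] at h2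
      exact absurd h2 (not_lt.2 (hca' k s ⟨h1, h3⟩))
    · intro l hl
      refine (isGLB_Ioo (hab k)).2 fun s hs => hl ⟨(hca0 k).trans hs.1, ?_⟩
      rw [hd s ((hc0 k).trans ((hca0 k).trans hs.1).le)]
      exact hab' k s hs
  · rw [hu1, hu2]
    refine IsLeast.isGLB ⟨⟨(hab k).trans (hbc k), hret k⟩, ?_⟩
    rintro s ⟨h1, h2⟩
    by_contra! h3
    rcases le_total s (b k) with h4 | h4
    · exact (hup k ⟨le_rfl, (hab k).le⟩ ⟨h1.le, h4⟩ h1).ne' h2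
    · have := hdown k ⟨h4, h3.le⟩ ⟨(hbc k).le, le_rfl⟩ h3
      rw [hret k] at this
      exact this.ne' h2
  · simp only [hu1, hu2]
    refine Asymptotics.IsBigO.trans_isLittleO (Asymptotics.IsBigO.of_bound 1 ?_) hosc
    refine Eventually.of_forall fun k => ?_
    have hge : ∀ s ∈ Icc (a k) (c (k + 1)), R (a k) ≤ R s ∧ R s ≤ R (b k) := by
      intro s hs
      rcases le_total s (b k) with h4 | h4
      · exact ⟨(hup k).monotoneOn ⟨le_rfl, (hab k).le⟩ ⟨hs.1, h4⟩ hs.1,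
          (hup k).monotoneOn ⟨hs.1, h4⟩ ⟨(hab k).le, le_rfl⟩ h4⟩
      · refine ⟨?_, (hdown k).antitoneOn ⟨le_rfl, (hbc k).le⟩ ⟨h4, hs.2⟩ h4⟩
        rw [← hret k]
        exact (hdown k).antitoneOn ⟨h4, hs.2⟩ ⟨(hbc k).le, le_rfl⟩ hs.2
    have hmem : R (a k) ∈ R '' Icc (a k) (c (k + 1)) :=
      mem_image_of_mem _ ⟨le_rfl, ((hab k).trans (hbc k)).le⟩
    have h1 : sSup (R '' Icc (a k) (c (k + 1))) ≤ R (b k) := by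
      refine csSup_le ⟨_, hmem⟩ ?_
      rintro _ ⟨s, hs, rfl⟩
      exact (hge s hs).2
    have h2 : R (a k) ≤ sInf (R '' Icc (a k) (c (k + 1))) := by
      refine le_csInf ⟨_, hmem⟩ ?_
      rintro _ ⟨s, hs, rfl⟩
      exact (hge s hs).1
    have h3 : R (a k) ≤ sSup (R '' Icc (a k) (c (k + 1))) := by
      refine le_csSup ⟨R (b k), ?_⟩ hmem
      rintro _ ⟨s, hs, rfl⟩
      exact (hge s hs).2
    have h4 : sInf (R '' Icc (a k) (c (k + 1))) ≤ R (a k) := by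
      refine csInf_le ⟨R (a k), ?_⟩ hmem
      rintro _ ⟨s, hs, rfl⟩
      exact (hge s hs).1
    rw [one_mul, oscOn, Real.norm_of_nonneg (by linarith), Real.norm_of_nonneg (by linarith)]
    linarith

/-- The radius of a wavy spiral is not monotone in the angle: it would have to increase somewhere,
and then it could not return to an earlier value. -/
theorem not_isWavySpiral_of_monotoneOn {g : ℝ → ℝ} {S : Set ℝ} (hg : MonotoneOn g S) :
    ¬ IsWavySpiral g S := by
  rintro ⟨t₀, φ, -, hmaps, hφ, -, -, -, t, h0, hinc, hret, ⟨hmono, -⟩, -⟩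
  have ht : ∀ k, t₀ ≤ t k := fun k => h0 ▸ hmono.monotone (Nat.zero_le k)
  rcases hφ with hφ | hφ
  · have hR : MonotoneOn (fun s => g (φ s)) (Ici t₀) := fun s hs u hu hsu =>
      hg (hmaps hs) (hmaps hu) (hφ.monotoneOn hs hu hsu)
    have h2 := hret 0
    have h12 : t (2 * 0 + 1) < t (2 * 0 + 2) := hmono (by norm_num)
    obtain ⟨s, hs1, hs2⟩ : {s : ℝ | t (2 * 0 + 1) < s ∧
        g (φ s) = g (φ (t (2 * 0 + 1)))}.Nonempty := h2.nonempty
    have hs3 : t (2 * 0 + 2) ≤ s := h2.1 ⟨hs1, hs2⟩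
    set v := (t (2 * 0 + 1) + t (2 * 0 + 2)) / 2 with hv
    have hv1 : t (2 * 0 + 1) < v := by linarith
    have hv2 : v < t (2 * 0 + 2) := by linarith
    have m1 := hR (ht (2 * 0 + 1)) ((ht (2 * 0 + 1)).trans hv1.le) hv1.le
    have m2 := hR ((ht (2 * 0 + 1)).trans hv1.le) ((ht (2 * 0 + 2)).trans hs3) (hv2.le.trans hs3)
    have hle : t (2 * 0 + 2) ≤ v := h2.1 ⟨hv1, le_antisymm (m2.trans hs2.le) m1⟩
    linarith
  · have hR : AntitoneOn (fun s => g (φ s)) (Ici t₀) := fun s hs u hu hsu =>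
      hg (hmaps hu) (hmaps hs) (hφ.antitoneOn hs hu hsu)
    obtain ⟨s, -, hs2⟩ := (hinc 0).nonempty
    exact absurd hs2 (not_lt.2 hR.derivWithin_nonpos)

/-- The polar angle, modulo `π`, at which the radius has a local minimum at time `t`. -/
noncomputable def critAngle (α κ t : ℝ) : ℝ := Real.arctan (κ / (2 * α * t))

namespace PruferPair

variable {α κ T : ℝ} {r θ : ℝ → ℝ}

theorem critAngle_pos (hα : 0 < α) (hκ : 0 < κ) {t : ℝ} (ht : 0 < t) : 0 < critAngle α κ t :=
  Real.arctan_pos.2 (by positivity)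

theorem critAngle_le (hα : 0 < α) {t : ℝ} (hκ : 0 < κ) (ht : FarOut α κ t) :
    critAngle α κ t ≤ Real.pi / 4 := by
  rw [critAngle, ← Real.arctan_one]
  refine Real.arctan_strictMono.monotone ?_
  have := ht.pos
  rw [div_le_one (by positivity)]
  linarith [ht.radius_lt]

theorem hasDerivAt_critAngle (hα : 0 < α) {t : ℝ} (ht : 0 < t) :
    HasDerivAt (critAngle α κ) (1 / (1 + (κ / (2 * α * t)) ^ 2) * (-κ / (2 * α * t ^ 2))) t := by
  have h : HasDerivAt (fun t : ℝ => κ / (2 * α * t)) (-κ / (2 * α * t ^ 2)) t := by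
    have h1 := (hasDerivAt_inv ht.ne').const_mul (κ / (2 * α))
    refine (h1.congr_deriv (by field_simp)).congr_of_eventuallyEq (Eventually.of_forall fun u => ?_)
    beta_reduce
    rw [← div_div, div_eq_mul_inv (κ / (2 * α)) u]
  exact h.arctan

/-- The factorization that shows the sign of the radial speed. -/
theorem slope_eq (hα : 0 < α) {t : ℝ} (ht : 0 < t) (ψ : ℝ) :
    Real.sin ψ * (-(2 * α / t) * Real.sin ψ + κ / t ^ 2 * Real.cos ψ) =
      -(2 * α / (t * Real.cos (critAngle α κ t))) *
        (Real.sin ψ * Real.sin (ψ - critAngle α κ t)) := by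
  have hc : 0 < Real.cos (critAngle α κ t) := Real.cos_arctan_pos _
  have h1 : Real.sin (critAngle α κ t) = κ / (2 * α * t) * Real.cos (critAngle α κ t) := by
    rw [← Real.tan_arctan (κ / (2 * α * t)), ← critAngle, Real.tan_mul_cos hc.ne']
  rw [Real.sin_sub, h1]
  field_simp
  ring

theorem sin_mul_sin_sub (ψ β : ℝ) (n : ℕ) : Real.sin ψ * Real.sin (ψ - β) =
    Real.sin (ψ + n * Real.pi) * Real.sin (ψ + n * Real.pi - β) := by
  have e : ψ + n * Real.pi - β = ψ - β + n * Real.pi := by ring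
  have h : ((-1 : ℝ) ^ n) * (-1) ^ n = 1 := by rw [← mul_pow]; simp
  rw [e, Real.sin_add_nat_mul_pi, Real.sin_add_nat_mul_pi]
  linear_combination (-(Real.sin ψ * Real.sin (ψ - β))) * h

/-- The radius increases while `θ` is between `-nπ` and `-nπ + β`, with `β` the critical angle. -/
theorem slope_pos (H : PruferPair α κ r θ) (hα : 0 < α) (hκ : 0 < κ) {t : ℝ}
    (ht : FarOut α κ t) (n : ℕ) (h1 : -(n * Real.pi) < θ t)
    (h2 : θ t - critAngle α κ t < -(n * Real.pi)) :
    0 < r t * (Real.sin (θ t) * (-(2 * α / t) * Real.sin (θ t) + κ / t ^ 2 * Real.cos (θ t))) := by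
  have ht0 := ht.pos
  have hβ := critAngle_le hα hκ ht
  have hpi := Real.pi_pos
  rw [slope_eq hα ht0, sin_mul_sin_sub _ _ n, neg_mul, ← mul_neg, ← mul_neg]
  have hc : 0 < Real.cos (critAngle α κ t) := Real.cos_arctan_pos _
  have s1 : 0 < Real.sin (θ t + n * Real.pi) :=
    Real.sin_pos_of_pos_of_lt_pi (by linarith) (by linarith)
  have s2 : Real.sin (θ t + n * Real.pi - critAngle α κ t) < 0 :=
    Real.sin_neg_of_neg_of_neg_pi_lt (by linarith) (by linarith)
  have := H.pos t ht0
  have s3 := mul_pos s1 (neg_pos.2 s2)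
  positivity

/-- The radius decreases while `θ` is between `-(n+1)π + β` and `-nπ`, with `β` the critical
angle. -/
theorem slope_neg (H : PruferPair α κ r θ) (hα : 0 < α) (hκ : 0 < κ) {t : ℝ}
    (ht : FarOut α κ t) (n : ℕ) (h1 : θ t < -(n * Real.pi))
    (h2 : -(n * Real.pi) - Real.pi < θ t - critAngle α κ t) :
    r t * (Real.sin (θ t) * (-(2 * α / t) * Real.sin (θ t) + κ / t ^ 2 * Real.cos (θ t))) < 0 := by
  have ht0 := ht.pos
  have hβ := critAngle_pos hα hκ ht0
  have hpi := Real.pi_pos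
  rw [slope_eq hα ht0, sin_mul_sin_sub _ _ n, neg_mul, mul_neg]
  have hc : 0 < Real.cos (critAngle α κ t) := Real.cos_arctan_pos _
  have s1 : Real.sin (θ t + n * Real.pi) < 0 :=
    Real.sin_neg_of_neg_of_neg_pi_lt (by linarith) (by linarith)
  have s2 : Real.sin (θ t + n * Real.pi - critAngle α κ t) < 0 :=
    Real.sin_neg_of_neg_of_neg_pi_lt (by linarith) (by linarith)
  have := H.pos t ht0
  have s3 := mul_pos_of_neg_of_neg s1 s2
  exact neg_neg_of_pos (by positivity)

theorem strictAntiOn_angle_sub_critAngle (H : PruferPair α κ r θ) (hα : 0 < α) (hκ : 0 < κ)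
    (hT : FarOut α κ T) : StrictAntiOn (fun t => θ t - critAngle α κ t) (Ici T) := by
  have hpos : ∀ u ∈ Ici T, 0 < u := fun u hu => hT.pos.trans_le hu
  have hder : ∀ u ∈ Ici T, HasDerivAt (fun t => θ t - critAngle α κ t) _ u := fun u hu =>
    (H.angle u (hpos u hu)).sub (hasDerivAt_critAngle hα (hpos u hu))
  refine strictAntiOn_of_deriv_neg (convex_Ici T)
    (fun u hu => (hder u hu).continuousAt.continuousWithinAt) fun u hu => ?_
  have hu : u ∈ Ici T := interior_subset hu
  have hu0 := hpos u hu
  have hF := hT.mono hα hu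
  rw [(hder u hu).deriv]
  have h1 := (angle_deriv_bounds (θ := θ) hα hκ.le hF).2
  have h2 : κ / (2 * α * u ^ 2) ≤ 1 / 4 := by
    rw [div_le_div_iff₀ (by positivity) (by norm_num)]
    have h3 : α * u ≤ α * u ^ 2 := by
      nlinarith [mul_nonneg (mul_pos hα hu0).le (sub_nonneg.2 hF.one_le)]
    linarith [hF.radius_lt]
  have h3 : 1 / (1 + (κ / (2 * α * u)) ^ 2) * (κ / (2 * α * u ^ 2)) ≤ κ / (2 * α * u ^ 2) := by
    refine mul_le_of_le_one_left (by positivity) ?_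
    rw [div_le_one (by positivity)]
    linarith [sq_nonneg (κ / (2 * α * u))]
  rw [neg_div, mul_neg]
  linarith

theorem exists_angle_sub_critAngle (H : PruferPair α κ r θ) (hα : 0 < α) (hκ : 0 < κ)
    (hT : FarOut α κ T) {v : ℝ} (hv : v ≤ θ T - critAngle α κ T) :
    ∃ t ∈ Ici T, θ t - critAngle α κ t = v := by
  have hpos : ∀ u ∈ Ici T, 0 < u := fun u hu => hT.pos.trans_le hu
  obtain ⟨u, hu1, hu2⟩ := (((H.tendsto_angle hα hκ.le hT).eventually_le_atBot v).and
    (eventually_ge_atTop T)).exists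
  have hc : ContinuousOn (fun t => θ t - critAngle α κ t) (Icc T u) := fun s hs =>
    ((H.angle s (hpos s hs.1)).sub
      (hasDerivAt_critAngle hα (hpos s hs.1))).continuousAt.continuousWithinAt
  obtain ⟨t, ht1, ht2⟩ := intermediate_value_Icc' hu2 hc
    ⟨by linarith [critAngle_pos hα hκ (hpos u hu2)], hv⟩
  exact ⟨t, ht1.1, ht2⟩

theorem continuousOn_slope (H : PruferPair α κ r θ) : ContinuousOn (fun t => r t * (Real.sin (θ t) *
    (-(2 * α / t) * Real.sin (θ t) + κ / t ^ 2 * Real.cos (θ t)))) (Ioi 0) := by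
  have h0 : ∀ t ∈ Ioi (0 : ℝ), t ≠ 0 := fun t ht => ne_of_gt ht
  have hr : ContinuousOn r (Ioi 0) := fun t ht => (H.radius t ht).continuousAt.continuousWithinAt
  have hθ : ContinuousOn θ (Ioi 0) := fun t ht => (H.angle t ht).continuousAt.continuousWithinAt
  have hs := Real.continuous_sin.comp_continuousOn hθ
  have hc := Real.continuous_cos.comp_continuousOn hθ
  exact hr.mul (hs.mul (((continuousOn_const.div continuousOn_id h0).neg.mul hs).add
    ((continuousOn_const.div (continuousOn_id.pow 2) fun t ht => pow_ne_zero 2 (h0 t ht)).mul hc)))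

theorem contDiffOn_radius (H : PruferPair α κ r θ) : ContDiffOn ℝ 1 r (Ioi 0) :=
  contDiffOn_one_of_hasDerivAt isOpen_Ioi H.radius H.continuousOn_slope

theorem contDiffOn_angle (H : PruferPair α κ r θ) : ContDiffOn ℝ 1 θ (Ioi 0) := by
  refine contDiffOn_one_of_hasDerivAt isOpen_Ioi H.angle ?_
  have h0 : ∀ t ∈ Ioi (0 : ℝ), t ≠ 0 := fun t ht => ne_of_gt ht
  have hθ : ContinuousOn θ (Ioi 0) := fun t ht => (H.angle t ht).continuousAt.continuousWithinAt
  have hs := Real.continuous_sin.comp_continuousOn hθ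
  have hc := Real.continuous_cos.comp_continuousOn hθ
  exact (continuousOn_const.sub ((continuousOn_const.div continuousOn_id h0).mul (hs.mul hc))).add
    ((continuousOn_const.div (continuousOn_id.pow 2) fun t ht => pow_ne_zero 2 (h0 t ht)).mul
      (hc.pow 2))

/-- The radius grows by `O(t^(-α-2))` in bounded time. -/
theorem radius_sub_le_rising (H : PruferPair α κ r θ) (hα : 0 < α) (hκ : 0 ≤ κ) {B : ℝ}
    (hB : 0 ≤ B) {s t : ℝ} (hs : 0 < s) (hst : s ≤ t) (hr : ∀ u ∈ Icc s t, r u ≤ B * u ^ (-α)) :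
    r t - r s ≤ B * κ * s ^ (-α - 2) * (t - s) := by
  have hpos : ∀ u ∈ Icc s t, 0 < u := fun u hu => hs.trans_le hu.1
  have h := antitoneOn_of_hasDerivAt (convex_Icc s t)
    (fun u hu => (H.radius u (hpos u hu)).sub
      ((hasDerivAt_id u).const_mul (B * κ * s ^ (-α - 2))))
    (fun u hu => by
      have hu0 := hpos u hu
      have hr0 := (H.pos u hu0).le
      have h1 : r u ≤ B * s ^ (-α) := (hr u hu).trans (by
        gcongr ?_ * ?_
        exact Real.rpow_le_rpow_of_nonpos hs hu.1 (by linarith))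
      have h2 : Real.sin (θ u) * (-(2 * α / u) * Real.sin (θ u) + κ / u ^ 2 * Real.cos (θ u)) ≤
          κ / s ^ 2 := by
        have a1 : 0 ≤ 2 * α / u * Real.sin (θ u) ^ 2 := by positivity
        have a2 : Real.sin (θ u) * Real.cos (θ u) ≤ 1 := by
          nlinarith [sq_nonneg (Real.sin (θ u) - Real.cos (θ u)), Real.sin_sq_add_cos_sq (θ u)]
        have a3 : κ / u ^ 2 * (Real.sin (θ u) * Real.cos (θ u)) ≤ κ / s ^ 2 :=
          (mul_le_of_le_one_right (by positivity) a2).trans (by gcongr; exact hu.1)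
        linarith
      have h3 : r u * (Real.sin (θ u) * (-(2 * α / u) * Real.sin (θ u) +
          κ / u ^ 2 * Real.cos (θ u))) ≤ B * κ * s ^ (-α - 2) := by
        have e : s ^ (-α - 2) = s ^ (-α) / s ^ 2 := by
          rw [Real.rpow_sub hs, Real.rpow_two]
        rw [e]
        calc _ ≤ r u * (κ / s ^ 2) := by gcongr
          _ ≤ B * s ^ (-α) * (κ / s ^ 2) := by gcongr
          _ = _ := by ring
      linarith)
    (left_mem_Icc.2 hst) (right_mem_Icc.2 hst) hst
  simp only [Pi.sub_apply, id] at h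
  linarith

/-- For `κ > 0` the time parametrization of the spiral is wavy. The increase after each minimum is
over before the next quarter turn brings the radius below the level of that minimum. -/
theorem isWavySpiral_polarRadius (H : PruferPair α κ r θ) (hα : 0 < α) (hκ : 0 < κ)
    (hT : FarOut α κ T) {B : ℝ} (hB : 0 < B) (hr : ∀ t ∈ Ici T, r t ≤ B * t ^ (-α)) :
    IsWavySpiral (polarRadius r θ T) (Iic (θ T)) := by
  have hpi := Real.pi_pos
  have hθanti := H.strictAntiOn_angle hα hκ.le hT
  have hψanti := H.strictAntiOn_angle_sub_critAngle hα hκ hT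
  obtain ⟨J, hJ⟩ := exists_nat_ge (-(θ T - critAngle α κ T) / Real.pi)
  rw [div_le_iff₀ hpi] at hJ
  have hβT := critAngle_pos hα hκ hT.pos
  have hJj : ∀ j : ℕ, -(((J + j : ℕ) : ℝ) * Real.pi) ≤ θ T - critAngle α κ T := fun j => by
    have : 0 ≤ (j : ℝ) * Real.pi := by positivity
    push_cast
    linarith
  -- `a j`: minima of the radius, `b j`: maxima, `d j`: a quarter turn after the maxima
  choose a haT ha using fun j : ℕ => H.exists_angle_sub_critAngle hα hκ hT (hJj j)
  choose b hbT hb using fun j : ℕ => H.exists_time hα hκ.le hT ((hJj j).trans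
    (show θ T - critAngle α κ T ≤ θ T by linarith))
  choose d hdT hd using fun j : ℕ => H.exists_time hα hκ.le hT
    (show -(((J + j : ℕ) : ℝ) * Real.pi) - Real.pi / 2 ≤ θ T by linarith [hJj j])
  have hβpos : ∀ t ∈ Ici T, 0 < critAngle α κ t := fun t ht =>
    critAngle_pos hα hκ (hT.pos.trans_le ht)
  have hβle : ∀ t ∈ Ici T, critAngle α κ t ≤ Real.pi / 4 := fun t ht =>
    critAngle_le hα hκ (hT.mono hα ht)
  have hsucc : ∀ j : ℕ, ((J + (j + 1) : ℕ) : ℝ) * Real.pi = ((J + j : ℕ) : ℝ) * Real.pi + Real.pi :=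
    fun j => by push_cast; ring
  have hab : ∀ j, a j < b j := fun j => by
    refine (hθanti.lt_iff_gt (hbT j) (haT j)).1 ?_
    linarith [ha j, hb j, hβpos _ (haT j)]
  have hbd : ∀ j, b j < d j := fun j => by
    refine (hθanti.lt_iff_gt (hdT j) (hbT j)).1 ?_
    linarith [hb j, hd j]
  have hda : ∀ j, Real.pi / 8 ≤ a (j + 1) - d j := fun j => by
    have h1 : d j < a (j + 1) := by
      refine (hψanti.lt_iff_gt (haT _) (hdT j)).1 ?_
      linarith [ha (j + 1), hd j, hβle _ (hdT j), hsucc j]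
    have h2 := (H.angle_sub_bounds hα hκ.le hT (hdT j) h1.le).2
    linarith [ha (j + 1), hd j, hβle _ (haT (j + 1)), hsucc j]
  set ρ : ℝ → ℝ := fun t => r t * (Real.sin (θ t) *
    (-(2 * α / t) * Real.sin (θ t) + κ / t ^ 2 * Real.cos (θ t))) with hρ
  have hup : ∀ j, ∀ s ∈ Ioo (a j) (b j), 0 < ρ s := fun j s hs => by
    have hsT : s ∈ Ici T := (haT j).trans hs.1.le
    refine H.slope_pos hα hκ (hT.mono hα hsT) (J + j) ?_ ?_
    · rw [← hb j]; exact hθanti hsT (hbT j) hs.2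
    · rw [← ha j]; exact hψanti (haT j) hsT hs.1
  have hdown : ∀ j, ∀ s ∈ Ioo (b j) (a (j + 1)), ρ s < 0 := fun j s hs => by
    have hsT : s ∈ Ici T := (hbT j).trans hs.1.le
    refine H.slope_neg hα hκ (hT.mono hα hsT) (J + j) ?_ ?_
    · rw [← hb j]; exact hθanti (hbT j) hsT hs.1
    · have : θ (a (j + 1)) - critAngle α κ (a (j + 1)) < θ s - critAngle α κ s :=
        hψanti hsT (haT (j + 1)) hs.2
      rw [ha, hsucc] at this
      linarith
  have hrc : ContinuousOn r (Ici T) := fun t ht =>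
    (H.radius t (hT.pos.trans_le ht)).continuousAt.continuousWithinAt
  have hba : ∀ j, r (a j) < r (b j) := fun j => by
    refine strictMonoOn_of_deriv_pos (convex_Icc (a j) (b j))
      (hrc.mono fun s hs => (haT j).trans hs.1) (fun s hs => ?_)
      ⟨le_rfl, (hab j).le⟩ ⟨(hab j).le, le_rfl⟩ (hab j)
    rw [interior_Icc] at hs
    rw [(H.radius s (hT.pos.trans_le ((haT j).trans hs.1.le))).deriv]
    exact hup j s hs
  have had : ∀ j, r (d j) < r (a j) := fun j => by
    have hle : a j ≤ d j := ((hab j).trans (hbd j)).le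
    have h1 := (H.angle_sub_bounds hα hκ.le hT (haT j) hle).1
    refine H.radius_lt hα hκ.le (hT.mono hα (haT j)) hle ?_ ?_
    · linarith [ha j, hd j, hβle _ (haT j)]
    · have e1 : sinSqPrimitive (θ (d j)) =
          (-(((J + j : ℕ) : ℝ) * Real.pi) - Real.pi / 2) / 2 := by
        rw [sinSqPrimitive, hd, Real.cos_sub_pi_div_two, Real.sin_neg, Real.sin_nat_mul_pi]
        ring
      have e2 : sinSqPrimitive (-(((J + j : ℕ) : ℝ) * Real.pi)) =
          -(((J + j : ℕ) : ℝ) * Real.pi) / 2 := by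
        rw [sinSqPrimitive, Real.sin_neg, Real.sin_nat_mul_pi]
        ring
      have e3 : sinSqPrimitive (-(((J + j : ℕ) : ℝ) * Real.pi)) ≤ sinSqPrimitive (θ (a j)) :=
        monotone_sinSqPrimitive (by linarith [ha j, hβpos _ (haT j)])
      rw [e1]
      linarith
  -- `c j`: the return to the level of the preceding minimum
  have hc : ∀ j, ∃ c ∈ Ioo (b j) (d j), r c = r (a j) := fun j => by
    obtain ⟨c, hc1, hc2⟩ := intermediate_value_Ioo' (hbd j).le
      (hrc.mono fun s hs => (hbT j).trans hs.1) ⟨had j, hba j⟩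
    exact ⟨c, hc1, hc2⟩
  choose c hcm hc using hc
  have hcT : T ≤ c 0 := (hbT 0).trans (hcm 0).1.le
  have hR : ∀ s, T ≤ s → polarRadius r θ T (θ s) = r s := fun s hs =>
    H.polarRadius_angle hα hκ.le hT hs
  have hIci : Ici (c 0) ⊆ Ioi 0 := fun s hs => hT.pos.trans_le (hcT.trans hs)
  have hatop : Tendsto a atTop atTop := by
    have h1 : ∀ j : ℕ, (j : ℝ) * (Real.pi / 2) + (T + (θ T - Real.pi / 4) / 2) ≤ a j := fun j => by
      have h2 := (H.angle_sub_bounds hα hκ.le hT le_rfl (haT j)).2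
      have h3 := ha j
      have h4 : 0 ≤ (J : ℝ) * Real.pi := by positivity
      push_cast at h3
      linarith [hβle _ (haT j)]
    refine tendsto_atTop_mono h1 (tendsto_atTop_add_const_right _ _ ?_)
    exact tendsto_natCast_atTop_atTop.atTop_mul_const (by positivity)
  refine ⟨c 0, θ, H.contDiffOn_angle.mono hIci, fun s hs => hθanti.antitoneOn self_mem_Ici
    (hcT.trans hs) (hcT.trans hs), Or.inr (hθanti.mono (Ici_subset_Ici.2 hcT)), ?_⟩
  refine isWavyFunction_of_turning_points (ρ := ρ) (a := fun k => a (k + 1))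
    (b := fun k => b (k + 1)) (ε := Real.pi / 8) (β := 1 / 2)
    ((H.contDiffOn_radius.mono hIci).congr fun s hs => hR s (hcT.trans hs)) (fun s hs => ?_)
    (fun s hs => ?_) ?_ (by positivity) (fun k => ?_) (fun k => hab _) (fun k => (hcm (k + 1)).1)
    (fun k s hs => ?_) (fun k => hup (k + 1)) (fun k s hs => ?_) (fun k => ?_)
    (hatop.comp (tendsto_add_atTop_nat 1)) ⟨by norm_num, by norm_num⟩ ?_
  · rw [hR s (hcT.trans hs)]
    exact H.pos s (hIci hs)
  · exact ((H.radius s (hIci hs)).hasDerivWithinAt).congr (fun u hu => hR u (hcT.trans hu))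
      (hR s (hcT.trans hs))
  · exact (hdown 0 (c 0) ⟨(hcm 0).1, (hcm 0).2.trans (by linarith [hda 0])⟩).le
  · linarith [hda k, (hcm k).2]
  · exact (hdown k s ⟨(hcm k).1.trans hs.1, hs.2⟩).le
  · exact hdown (k + 1) s ⟨hs.1, hs.2.trans ((hcm (k + 1)).2.trans (by linarith [hda (k + 1)]))⟩
  · rw [hR _ ((hbT (k + 1)).trans (hcm (k + 1)).1.le), hR _ (haT (k + 1)), hc]
  · have hO : (fun k : ℕ => polarRadius r θ T (θ (b (k + 1))) - polarRadius r θ T (θ (a (k + 1))))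
        =O[atTop] fun k => a (k + 1) ^ (-α - 2) := by
      refine Asymptotics.IsBigO.of_bound (B * κ * (Real.pi / 2)) (Eventually.of_forall fun k => ?_)
      have ha0 : 0 < a (k + 1) := hT.pos.trans_le (haT _)
      rw [hR _ (haT _), hR _ (hbT _), Real.norm_of_nonneg (by linarith [hba (k + 1)]),
        Real.norm_of_nonneg (by positivity)]
      have h1 := H.radius_sub_le_rising hα hκ.le hB.le ha0 (hab (k + 1)).le
        fun u hu => hr u ((haT _).trans hu.1)
      have h2 := (H.angle_sub_bounds hα hκ.le hT (haT (k + 1)) (hab (k + 1)).le).1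
      have h3 : b (k + 1) - a (k + 1) ≤ Real.pi / 2 := by
        linarith [ha (k + 1), hb (k + 1), hβle _ (haT (k + 1))]
      calc _ ≤ B * κ * a (k + 1) ^ (-α - 2) * (b (k + 1) - a (k + 1)) := h1
        _ ≤ B * κ * a (k + 1) ^ (-α - 2) * (Real.pi / 2) := by gcongr
        _ = _ := by ring
    have ho : (fun t : ℝ => t ^ (-α - 2)) =o[atTop] fun t => t ^ (-(1 / 2 : ℝ) - 1) :=
      isLittleO_rpow_atTop_of_lt (by linarith)
    exact hO.trans_isLittleO (ho.comp_tendsto (hatop.comp (tendsto_add_atTop_nat 1)))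

/-- For `κ = 0` the radial speed is `-(2α/t) r sin² θ ≤ 0`. -/
theorem monotoneOn_polarRadius (H : PruferPair α 0 r θ) (hα : 0 < α) (hT : FarOut α 0 T) :
    MonotoneOn (polarRadius r θ T) (Iic (θ T)) := by
  have hanti : AntitoneOn r (Ici T) :=
    antitoneOn_of_hasDerivAt (convex_Ici T) (fun t ht => H.radius t (hT.pos.trans_le ht))
      fun t ht => by
        have ht0 : 0 < t := hT.pos.trans_le ht
        have h1 := H.pos t ht0
        have h2 : 0 ≤ r t * (2 * α / t * Real.sin (θ t) ^ 2) := by positivity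
        rw [zero_div, zero_mul]
        linarith
  intro ψ₁ h₁ ψ₂ h₂ h
  obtain ⟨t₁, ht₁, rfl⟩ := H.exists_time hα le_rfl hT h₁
  obtain ⟨t₂, ht₂, rfl⟩ := H.exists_time hα le_rfl hT h₂
  rw [H.polarRadius_angle hα le_rfl hT ht₁, H.polarRadius_angle hα le_rfl hT ht₂]
  exact hanti ht₂ ht₁ (((H.strictAntiOn_angle hα le_rfl hT).le_iff_ge ht₁ ht₂).1 h)

end PruferPair

/-! ### The spirals of the generalized Bessel functions -/

/-- Points of the phase curve before the time `T` stay away from the origin. -/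
theorem SolvesPhase.exists_phaseCurve_inter_ball {α κ τ T A : ℝ} {x y : ℝ → ℝ}
    (H : SolvesPhase α κ x y) (hα : 0 < α) (hτ : 0 < τ) (hT : τ ≤ T) (hA : 0 < A)
    (hr : ∀ t ∈ Ici τ, A * t ^ (-α) ≤ Real.sqrt (x t ^ 2 + y t ^ 2)) :
    ∃ δ : ℝ, 0 < δ ∧
      phaseCurve x τ ∩ Metric.ball 0 δ = phaseCurve x T ∩ Metric.ball 0 δ := by
  have hT0 : 0 < T := hτ.trans_le hT
  refine ⟨A * T ^ (-α), by positivity, ?_⟩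
  rw [H.phaseCurve_eq hτ, H.phaseCurve_eq hT0]
  ext p
  constructor
  · rintro ⟨⟨t, ht, rfl⟩, hp⟩
    refine ⟨⟨t, ?_, rfl⟩, hp⟩
    by_contra htT
    have htT : t < T := not_le.1 htT
    have h1 := hr t ht
    rw [mem_ball_zero_iff, norm_toLp_pair] at hp
    have h2 : T ^ (-α) ≤ t ^ (-α) :=
      Real.rpow_le_rpow_of_nonpos (hτ.trans_le ht) htT.le (by linarith)
    have h3 := mul_le_mul_of_nonneg_left h2 hA.le
    linarith
  · rintro ⟨⟨t, ht, rfl⟩, hp⟩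
    exact ⟨⟨t, hT.trans ht, rfl⟩, hp⟩

theorem theorem1 (μ ν τ₀ : ℝ) (hμ : μ ∈ Set.Ioo (0 : ℝ) 2) (hτ₀ : 0 < τ₀)
    (x : ℝ → ℝ) (hx : x = genBesselJ ν μ ∨ x = genBesselY ν μ) :
    HasPhaseDim x τ₀ (4 / (4 - μ)) ∧
    (∃ φ : ℝ → ℝ, IsPhaseFunction x τ₀ φ) ∧
    ∀ φ : ℝ → ℝ, IsPhaseFunction x τ₀ φ →
      ∃ s : ℝ, (s = 0 ∨ s = Real.pi) ∧
        (∀ t ∈ Set.Ici τ₀, x t = phaseRadius x t * Real.cos (φ t + s) ∧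
          deriv x t = phaseRadius x t * Real.sin (φ t + s)) ∧
        ∃ (T φ₀ : ℝ) (g : ℝ → ℝ), τ₀ ≤ T ∧ 0 < φ₀ ∧
          StrictAntiOn (fun t => φ t + s) (Set.Ici T) ∧
          (fun t => φ t + s) '' Set.Ici T = Set.Iic (-φ₀) ∧
          (∀ t ∈ Set.Ici T, g (φ t + s) = phaseRadius x t) ∧
          phaseCurve x T = polarGraph g (Set.Iic (-φ₀)) ∧
          (∃ δ : ℝ, 0 < δ ∧ phaseCurve x τ₀ ∩ Metric.ball 0 δ =
            polarGraph g (Set.Iic (-φ₀)) ∩ Metric.ball 0 δ) ∧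
          IsNegSpiral g (-φ₀) ∧
          (∃ C D : ℝ, 0 < C ∧ 0 < D ∧ ∀ᶠ θ : ℝ in Filter.atBot,
            C * |θ| ^ (-((2 - μ) / 2)) ≤ g θ ∧ g θ ≤ D * |θ| ^ (-((2 - μ) / 2))) ∧
          (IsWavySpiral g (Set.Iic (-φ₀)) ↔ ν ≠ 0) := by
  obtain ⟨y, H, t₀, ht₀, hxt₀⟩ := exists_solvesPhase_genBessel hx
  have hα : 0 < (2 - μ) / 2 := by linarith [hμ.2]
  have hα' : (2 - μ) / 2 < 1 := by linarith [hμ.1]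
  have hdim : 4 / (4 - μ) = 2 / (1 + (2 - μ) / 2) := by
    have h4 : 4 - μ ≠ 0 := by linarith [hμ.2]
    have h1 : 1 + (2 - μ) / 2 ≠ 0 := by linarith
    rw [div_eq_div_iff h4 h1]
    ring
  have hκ : 0 ≤ ν ^ 2 := sq_nonneg ν
  set α := (2 - μ) / 2
  have hpos : ∀ t ∈ Ici τ₀, 0 < t := fun t ht => hτ₀.trans_le ht
  obtain ⟨A, B, hA, hB, hr⟩ := H.exists_radius_bounds ht₀ hxt₀ hτ₀
  obtain ⟨θ, P, hpol⟩ := H.exists_pruferPair fun t ht => H.sq_add_sq_pos ht₀ hxt₀ ht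
  set r : ℝ → ℝ := fun t => Real.sqrt (x t ^ 2 + y t ^ 2)
  have hpol : ∀ t, 0 < t → x t = r t * Real.cos (θ t) ∧ y t = r t * Real.sin (θ t) := hpol
  have hθc := P.continuousOn_angle hτ₀
  refine ⟨⟨fun t ht => H.contDiffOn.contDiffAt (Ioi_mem_nhds (hpos t ht)), ?_⟩, ⟨θ, hθc, ?_⟩, ?_⟩
  · rw [hdim]
    exact H.hasBoxDim_phaseCurve hα hα' hκ hτ₀ ht₀ hxt₀
  · intro t ht hxt
    obtain ⟨h1, h2⟩ := hpol t (hpos t ht)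
    rw [h1] at hxt
    rw [(H t (hpos t ht)).1.deriv, h1, h2,
      mul_div_mul_left _ _ (left_ne_zero_of_mul hxt), Real.tan_eq_sin_div_cos]
    exact ⟨right_ne_zero_of_mul hxt, rfl⟩
  · intro φ hφ
    obtain ⟨s, hs, k, hk⟩ := phaseFunction_eq (fun t ht => (H t (hpos t ht)).1)
      (fun t ht => P.pos t (hpos t ht)) hθc (fun t ht => hpol t (hpos t ht)) hφ
    have hrad : ∀ t ∈ Ici τ₀, phaseRadius x t = r t := fun t ht => H.phaseRadius_eq (hpos t ht)
    have P' := P.add_int_mul_two_pi k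
    have hpol' : ∀ t, 0 < t → x t = r t * Real.cos (θ t + k * (2 * Real.pi)) ∧
        y t = r t * Real.sin (θ t + k * (2 * Real.pi)) := fun t ht => by
      rw [Real.cos_add_int_mul_two_pi, Real.sin_add_int_mul_two_pi]
      exact hpol t ht
    set ϑ : ℝ → ℝ := fun t => θ t + k * (2 * Real.pi)
    refine ⟨s, hs, fun t ht => ?_, ?_⟩
    · rw [hk t ht, hrad t ht, (H t (hpos t ht)).1.deriv]
      exact hpol' t (hpos t ht)
    obtain ⟨T₀, hT₀⟩ := (eventually_farOut hα (ν ^ 2)).exists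
    obtain ⟨T, hT, hTτ, hneg⟩ := ((eventually_farOut hα (ν ^ 2)).and
      ((eventually_ge_atTop τ₀).and
        ((P'.tendsto_angle hα hκ hT₀).eventually_lt_atBot 0))).exists
    have hsub : Ici T ⊆ Ici τ₀ := Ici_subset_Ici.2 hTτ
    have hkT : ∀ t ∈ Ici T, φ t + s = ϑ t := fun t ht => hk t (hsub ht)
    have hrT := fun t (ht : t ∈ Ici T) => hr t (hsub ht)
    have hgraph : phaseCurve x T = polarGraph (polarRadius r ϑ T) (Iic (ϑ T)) := by
      rw [P'.polarGraph_polarRadius hα hκ hT, H.phaseCurve_eq hT.pos]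
      refine image_congr fun t ht => ?_
      obtain ⟨h1, h2⟩ := hpol' t (hT.pos.trans_le ht)
      rw [← h1, ← h2]
    refine ⟨T, -ϑ T, polarRadius r ϑ T, hTτ, by linarith, ?_⟩
    rw [neg_neg]
    refine ⟨(P'.strictAntiOn_angle hα hκ hT).congr fun t ht => (hkT t ht).symm, ?_,
      fun t ht => ?_, hgraph, ?_, P'.isNegSpiral hα hκ hT hneg hA hB hrT, ?_, ?_⟩
    · rw [image_congr hkT]
      exact P'.image_Ici hα hκ hT
    · rw [hkT t ht, hrad t (hsub ht)]
      exact P'.polarRadius_angle hα hκ hT ht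
    · rw [← hgraph]
      exact H.exists_phaseCurve_inter_ball hα hτ₀ hTτ hA fun t ht => (hr t ht).1
    · obtain ⟨C, D, hC, hD, h⟩ := P'.polarRadius_bounds hα hκ hT hneg hA hB hrT
      exact ⟨C, D, hC, hD, (eventually_le_atBot (ϑ T)).mono h⟩
    · constructor
      · rintro hw rfl
        rw [zero_pow two_ne_zero] at P' hT
        exact not_isWavySpiral_of_monotoneOn (P'.monotoneOn_polarRadius hα hT) hw
      · intro hν
        exact P'.isWavySpiral_polarRadius hα (by positivity) hT hB fun t ht => (hrT t ht).2
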